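/- For a closed set $E\subset\mathbb{R}^3$ and $\rho>0$, let the $\rho$-hulloid $\mathrm{co}_\rho(E)$ be the intersection of the complements of all open balls of radius $\rho$ that do not meet $E$. Let $V=\{v_1,v_2,v_3,v_4\}$ be the set of vertices of a (non-degenerate) tetrahedron $T=\mathrm{co}(V)\subset\mathbb{R}^3$ with circumradius $r(V)$, and let $$R^*=r_L(V)=\inf\{\rho>r(V): \mathrm{int}(\mathrm{co}_\rho(V))\neq\emptyset\}\ \ (\ge r(V)).$$ For every $\rho>r(V)$ and $1\le i\le 4$ there is a unique point $o_i(\rho)$ such that the sphere $\partial B(o_i(\rho),\rho)$ contains $V\setminus\{v_i\}$ and $v_i\notin B(o_i(\rho),\rho)$; write $B_i(\rho)=B(o_i(\rho),\rho)$ for this open ball. Then: 1. $\mathrm{co}_\rho(V)=V$ for $0<\rho<R^*$. 2. For $\rho>R^*$, $\mathrm{co}_\rho(V)=V\cup\tilde\Gamma$ with $\tilde\Gamma=\mathrm{int}(T)\setminus\bigcup_{i=1}^4 B_i(\rho)$. The set $\tilde\Gamma$ is nonempty and connected, and $\partial\tilde\Gamma=S_1\cup S_2\cup S_3\cup S_4$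 with each $S_i$ a nonempty connected subset of $\partial B_i(\rho)$. 3. For $\rho=R^*$: if $r_L(V)>r(V)$, then the four spheres $\partial B_i(R^*)$ intersect in exactly one point $O^*$, this point lies in $\mathrm{int}(T)$, and $\mathrm{co}_{R^*}(V)=V\cup\{O^*\}$; if $r_L(V)=r(V)$, then $\mathrm{co}_{R^*}(V)=V$. -/

import Mathlib

open Metric Set

/-- Euclidean three-space. -/
abbrev E3 : Type := EuclideanSpace ℝ (Fin 3)

/-- The `R`-hulloid of `E`: the intersection of the complements of all open balls of radius `R`
that do not meet `E` (the whole space if there is no such ball). -/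
def hulloid (R : ℝ) (E : Set E3) : Set E3 :=
  ⋂ (x : E3) (_ : ball x R ∩ E = ∅), (ball x R)ᶜ

/-- The set `V` of vertices of a tetrahedron. -/
def vertexSet (T : Affine.Simplex ℝ E3 3) : Set E3 := range T.points

/-- The solid tetrahedron `co(V)`. -/
def solid (T : Affine.Simplex ℝ E3 3) : Set E3 := convexHull ℝ (vertexSet T)

/-- A hulloid is full if it has nonempty interior. -/
def IsFull (T : Affine.Simplex ℝ E3 3) (ρ : ℝ) : Prop :=
  (interior (hulloid ρ (vertexSet T))).Nonempty

/-- `r_L(V) = inf {ρ > r(V) : co_ρ(V) is full}`, with `r(V)` the circumradius. -/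
noncomputable def criticalRadius (T : Affine.Simplex ℝ E3 3) : ℝ :=
  sInf {ρ : ℝ | T.circumradius < ρ ∧ IsFull T ρ}

/-- `p` is a centre of a sphere of radius `ρ` through the three vertices other than the `i`-th,
such that the open ball does not contain the `i`-th vertex. -/
def IsFaceCenter (T : Affine.Simplex ℝ E3 3) (i : Fin 4) (ρ : ℝ) (p : E3) : Prop :=
  (∀ j, j ≠ i → T.points j ∈ sphere p ρ) ∧ T.points i ∉ ball p ρ

/-- The set `int(T) \ ⋃ B(o_i, ρ)`. -/
def innerPart (T : Affine.Simplex ℝ E3 3) (o : Fin 4 → E3) (ρ : ℝ) : Set E3 :=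
  interior (solid T) \ ⋃ i, ball (o i) ρ

/-! Let λ_i be the barycentric coordinates, O the circumcentre, r the circumradius and P(x) = r² −
|x − O|². A difference of two squared distances is affine, so the ball of radius ρ with respect to
which the vertices have powers a_i is {Σ a_i λ_i < P}. It misses V exactly when all a_i ≥ 0, and B_i
is the case where only a_i = k_i (`ratio`) is nonzero. The possible a satisfy q(a) = ρ² − r² with q
a convex quadratic and q(0) = 0. Since each k_i e_i is a solution, convexity forces Σ a_i / k_i ≥ 1
for every a ≥ 0 (`one_le_sum_div_ratio`). Where 0 < P ≤ k_i λ_i for all i (`core`) this gives P ≤ Σ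
a_i λ_i, so for ρ > r the face balls alone decide the hulloid (`hulloid_eq`).

On the core, λ_i / P = 1 / k_i + t λ_i(w) with t ≥ 0 and w in T, and the definition of P becomes a
quadratic equation for t with right-hand side `excess`. If the excess is positive, its positive root
is a continuous function of w on a convex domain, so the core and its faces are connected
(`core_eq_image`). If it is zero, the core is the common point of the four spheres; if negative, the
core is empty. The k_i increase strictly with ρ, so the excess is positive beyond R*, and by
continuity it vanishes at R* when R* > r.

At ρ = r some k_i may vanish, so `hulloid_circumradius` needs another argument: a planar section
reduces it to a rigidity statement about three discs covering a circle. Smaller radii follow by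
monotonicity. -/

open scoped RealInnerProductSpace

/-! ### Barycentric coordinates and the power of a point -/

namespace Affine.Simplex

variable (T : Affine.Simplex ℝ E3 3)

/-- The vertices of a tetrahedron as an affine basis of the space. -/
noncomputable def basis : AffineBasis (Fin 4) ℝ E3 where
  toFun := T.points
  ind' := T.independent
  tot' := (T.independent.affineSpan_eq_top_iff_card_eq_finrank_add_one).2 (by simp)

@[simp] lemma basis_apply (i : Fin 4) : T.basis i = T.points i := rfl

/-- The `i`-th barycentric coordinate. -/
noncomputable def bary (i : Fin 4) (x : E3) : ℝ := T.basis.coord i x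

/-- The gradient of the `i`-th barycentric coordinate. -/
noncomputable def baryGrad (i : Fin 4) : E3 :=
  (InnerProductSpace.toDual ℝ E3).symm
    (LinearMap.toContinuousLinearMap (T.basis.coord i).linear)

/-- Minus the power of a point with respect to the circumsphere. -/
noncomputable def power (x : E3) : ℝ := T.circumradius ^ 2 - ‖x - T.circumcenter‖ ^ 2

lemma bary_eq_add (i : Fin 4) (x y : E3) :
    T.bary i y = T.bary i x + ⟪T.baryGrad i, y - x⟫ := by
  have h := (T.basis.coord i).map_vadd x (y - x)
  simp only [vadd_eq_add, sub_add_cancel] at h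
  simp only [bary, baryGrad, InnerProductSpace.toDual_symm_apply]
  rw [h, add_comm]; rfl

lemma continuous_bary (i : Fin 4) : Continuous (T.bary i) := by
  have : T.bary i = fun y => T.bary i 0 + ⟪T.baryGrad i, y - 0⟫ :=
    funext fun y => T.bary_eq_add i 0 y
  rw [this]; fun_prop

lemma continuous_power : Continuous T.power := by
  unfold power; fun_prop

lemma sum_bary (x : E3) : ∑ i, T.bary i x = 1 := T.basis.sum_coord_apply_eq_one x

lemma sum_bary_smul_sub (x c : E3) : ∑ i, T.bary i x • (T.points i - c) = x - c := by
  have h := T.basis.linear_combination_coord_eq_self x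
  simp only [smul_sub, Finset.sum_sub_distrib, ← Finset.sum_smul]
  rw [T.sum_bary, one_smul]
  congr 1

lemma bary_point (i j : Fin 4) : T.bary i (T.points j) = if i = j then 1 else 0 :=
  T.basis.coord_apply i j

lemma bary_point_self (i : Fin 4) : T.bary i (T.points i) = 1 := by simp [bary_point]

lemma bary_point_ne {i j : Fin 4} (h : i ≠ j) : T.bary i (T.points j) = 0 := by
  simp [bary_point, h]

lemma bary_ext {x y : E3} (h : ∀ i, T.bary i x = T.bary i y) : x = y := T.basis.ext_elem h

lemma inner_baryGrad_sub (i j : Fin 4) (c : E3) :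
    ⟪T.baryGrad i, T.points j - c⟫ = (if i = j then 1 else 0) - T.bary i c := by
  have := T.bary_eq_add i c (T.points j)
  rw [bary_point] at this; linarith

lemma baryGrad_ne_zero (i : Fin 4) : T.baryGrad i ≠ 0 := by
  intro h
  obtain ⟨j, hj⟩ : ∃ j : Fin 4, i ≠ j := ⟨i + 1, by fin_cases i <;> decide⟩
  have := T.bary_eq_add i (T.points i) (T.points j)
  simp [h, bary_point, hj] at this

lemma norm_baryGrad_pos (i : Fin 4) : 0 < ‖T.baryGrad i‖ ^ 2 :=
  pow_pos (norm_pos_iff.2 (T.baryGrad_ne_zero i)) 2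

lemma norm_point_sub (i : Fin 4) : ‖T.points i - T.circumcenter‖ = T.circumradius := by
  rw [← dist_eq_norm]; exact T.dist_circumcenter_eq_circumradius i

lemma power_point (i : Fin 4) : T.power (T.points i) = 0 := by
  simp [power, norm_point_sub]

/-- Expand about the circumcentre, from which all vertices have the same distance. On T every
summand is nonnegative, so there P vanishes only at vertices. -/
lemma power_eq_sum (x : E3) : T.power x = ∑ i, T.bary i x * ‖T.points i - x‖ ^ 2 := by
  have h1 : ∀ i, ‖T.points i - x‖ ^ 2 = T.circumradius ^ 2 + ‖x - T.circumcenter‖ ^ 2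
      - 2 * ⟪T.points i - T.circumcenter, x - T.circumcenter⟫ := by
    intro i
    rw [← sub_sub_sub_cancel_right (T.points i) x T.circumcenter, norm_sub_sq_real,
      norm_point_sub]
    ring
  have h2 : ∑ i, T.bary i x * ⟪T.points i - T.circumcenter, x - T.circumcenter⟫
      = ‖x - T.circumcenter‖ ^ 2 := by
    rw [← real_inner_self_eq_norm_sq]
    nth_rewrite 2 [← T.sum_bary_smul_sub x T.circumcenter]
    rw [sum_inner]
    simp [real_inner_smul_left]
  simp only [h1]
  have h3 : ∀ i, T.bary i x * (T.circumradius ^ 2 + ‖x - T.circumcenter‖ ^ 2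
      - 2 * ⟪T.points i - T.circumcenter, x - T.circumcenter⟫) =
      T.bary i x * (T.circumradius ^ 2 + ‖x - T.circumcenter‖ ^ 2) -
      2 * (T.bary i x * ⟪T.points i - T.circumcenter, x - T.circumcenter⟫) := fun i => by ring
  simp only [h3]
  rw [Finset.sum_sub_distrib, ← Finset.sum_mul, ← Finset.mul_sum, h2, sum_bary, power]
  ring

lemma power_nonneg {x : E3} (h : ∀ i, 0 ≤ T.bary i x) : 0 ≤ T.power x := by
  rw [power_eq_sum]
  exact Finset.sum_nonneg fun i _ => mul_nonneg (h i) (sq_nonneg _)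

lemma mem_vertexSet_of_power_eq_zero {x : E3} (h : ∀ i, 0 ≤ T.bary i x)
    (h0 : T.power x = 0) : x ∈ vertexSet T := by
  rw [power_eq_sum, Finset.sum_eq_zero_iff_of_nonneg
    fun i _ => mul_nonneg (h i) (sq_nonneg _)] at h0
  by_contra hx
  have : ∀ i, T.bary i x = 0 := by
    intro i
    rcases mul_eq_zero.1 (h0 i (Finset.mem_univ i)) with h' | h'
    · exact h'
    · exact absurd ⟨i, sub_eq_zero.1 (norm_eq_zero.1 (pow_eq_zero_iff (two_ne_zero) |>.1 h'))⟩ hx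
  have hs := T.sum_bary x
  simp [this] at hs

lemma mem_interior_solid {x : E3} : x ∈ interior (solid T) ↔ ∀ i, 0 < T.bary i x := by
  have h := T.basis.interior_convexHull
  have h' : (range T.basis) = vertexSet T := rfl
  rw [h'] at h
  rw [solid, h]; rfl

lemma notMem_vertexSet_of_bary_pos {x : E3} (h : ∀ i, 0 < T.bary i x) : x ∉ vertexSet T := by
  rintro ⟨i, rfl⟩
  obtain ⟨j, hj⟩ : ∃ j : Fin 4, j ≠ i := ⟨i + 1, by fin_cases i <;> decide⟩
  exact (h j).ne' (T.bary_point_ne hj)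

lemma power_pos {x : E3} (h : ∀ i, 0 < T.bary i x) : 0 < T.power x :=
  (T.power_nonneg fun i => (h i).le).lt_of_ne fun h0 =>
    T.notMem_vertexSet_of_bary_pos h
      (T.mem_vertexSet_of_power_eq_zero (fun i => (h i).le) h0.symm)

/-- A vector is determined by its inner products with the edges. -/
lemma eq_sum_baryGrad (a : Fin 4 → ℝ) (q c : E3) (d : ℝ)
    (h : ∀ i, ⟪q, T.points i - c⟫ + d = a i) :
    q = ∑ i, a i • T.baryGrad i ∧ d = ∑ i, a i * T.bary i c := by
  have key : ∀ y, ⟪q, y - c⟫ + d = ∑ i, a i * T.bary i y := by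
    intro y
    simp only [← h]
    nth_rewrite 1 [← T.sum_bary_smul_sub y c]
    simp only [inner_sum, real_inner_smul_right, add_mul, Finset.sum_add_distrib,
      ← Finset.mul_sum, sum_bary, mul_one]
    congr 1
    exact Finset.sum_congr rfl fun i _ => mul_comm _ _
  have hd : d = ∑ i, a i * T.bary i c := by simpa using key c
  refine ⟨ext_inner_right ℝ fun z => ?_, hd⟩
  have h1 := key (c + z)
  simp only [T.bary_eq_add _ c (c + z), add_sub_cancel_left, mul_add, Finset.sum_add_distrib] at h1
  rw [sum_inner]
  simp only [real_inner_smul_left]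
  linarith

end Affine.Simplex

/-! ### Balls of radius ρ in terms of the powers of the vertices -/

namespace Affine.Simplex

variable (T : Affine.Simplex ℝ E3 3)

/-- The ball of radius `ρ` through the face opposite to the `i`-th vertex is
`{y | T.ratio i ρ * T.bary i y < T.power y}`. -/
noncomputable def ratio (i : Fin 4) (ρ : ℝ) : ℝ :=
  2 * (T.bary i T.circumcenter + √(T.bary i T.circumcenter ^ 2 +
    ‖T.baryGrad i‖ ^ 2 * (ρ ^ 2 - T.circumradius ^ 2))) / ‖T.baryGrad i‖ ^ 2

/-- The centre of the sphere of radius `ρ` through the face opposite to the `i`-th vertex. -/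
noncomputable def faceCenter (ρ : ℝ) (i : Fin 4) : E3 :=
  T.circumcenter - (T.ratio i ρ / 2) • T.baryGrad i

variable {T} {ρ : ℝ}

lemma sq_sub_nonneg (hρ : T.circumradius ≤ ρ) : 0 ≤ ρ ^ 2 - T.circumradius ^ 2 :=
  sub_nonneg.2 (pow_le_pow_left₀ T.circumradius_nonneg hρ 2)

lemma sq_sub_pos (hρ : T.circumradius < ρ) : 0 < ρ ^ 2 - T.circumradius ^ 2 :=
  sub_pos.2 (pow_lt_pow_left₀ hρ T.circumradius_nonneg two_ne_zero)

lemma ratio_eq (hρ : T.circumradius ≤ ρ) (i : Fin 4) :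
    ‖T.baryGrad i‖ ^ 2 * T.ratio i ρ ^ 2 / 4 - T.bary i T.circumcenter * T.ratio i ρ =
      ρ ^ 2 - T.circumradius ^ 2 := by
  have hg := T.norm_baryGrad_pos i
  have hs := Real.sq_sqrt (add_nonneg (sq_nonneg (T.bary i T.circumcenter))
    (mul_nonneg hg.le (sq_sub_nonneg hρ)))
  unfold ratio
  set g := ‖T.baryGrad i‖ ^ 2
  set s := √(T.bary i T.circumcenter ^ 2 + g * (ρ ^ 2 - T.circumradius ^ 2))
  set m := T.bary i T.circumcenter
  have : g * (2 * (m + s) / g) ^ 2 / 4 - m * (2 * (m + s) / g) = (s ^ 2 - m ^ 2) / g := by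
    field_simp; ring
  rw [this, hs]; field_simp; ring

lemma ratio_nonneg (hρ : T.circumradius ≤ ρ) (i : Fin 4) : 0 ≤ T.ratio i ρ := by
  have hg := T.norm_baryGrad_pos i
  have : |T.bary i T.circumcenter| ≤ √(T.bary i T.circumcenter ^ 2 +
      ‖T.baryGrad i‖ ^ 2 * (ρ ^ 2 - T.circumradius ^ 2)) :=
    Real.abs_le_sqrt (le_add_of_nonneg_right (mul_nonneg hg.le (sq_sub_nonneg hρ)))
  have h2 := neg_abs_le (T.bary i T.circumcenter)
  exact div_nonneg (by linarith) hg.le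

lemma ratio_pos (hρ : T.circumradius < ρ) (i : Fin 4) : 0 < T.ratio i ρ := by
  refine (ratio_nonneg hρ.le i).lt_of_ne fun h => ?_
  have := ratio_eq hρ.le i
  rw [← h] at this
  have := sq_sub_pos hρ
  simp at *
  linarith

/-- Since ρ² − r² > 0, the two roots of the quadratic have opposite signs. -/
lemma eq_ratio (hρ : T.circumradius < ρ) (i : Fin 4) {k : ℝ} (hk : 0 ≤ k)
    (h : ‖T.baryGrad i‖ ^ 2 * k ^ 2 / 4 - T.bary i T.circumcenter * k =
      ρ ^ 2 - T.circumradius ^ 2) : k = T.ratio i ρ := by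
  have h1 := ratio_eq hρ.le i
  have h2 := ratio_pos hρ i
  have h3 := sq_sub_pos hρ
  have hg := T.norm_baryGrad_pos i
  set g := ‖T.baryGrad i‖ ^ 2
  set m := T.bary i T.circumcenter
  set K := T.ratio i ρ
  have h4 : (k - K) * (g * k * K / 4 + (ρ ^ 2 - T.circumradius ^ 2)) = 0 := by
    linear_combination K * h - k * h1
  rcases mul_eq_zero.1 h4 with h5 | h5
  · linarith
  · have : 0 ≤ g * k * K / 4 := by positivity
    linarith

lemma ratio_lt {ρ' : ℝ} (hρ : T.circumradius < ρ) (h : ρ < ρ') (i : Fin 4) :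
    T.ratio i ρ < T.ratio i ρ' := by
  have hg := T.norm_baryGrad_pos i
  have h0 := sq_sub_pos hρ
  have hr : ρ ^ 2 < ρ' ^ 2 := pow_lt_pow_left₀ h (T.circumradius_nonneg.trans hρ.le) two_ne_zero
  unfold ratio
  gcongr

lemma continuous_ratio (i : Fin 4) : Continuous (T.ratio i) := by
  unfold ratio; fun_prop

lemma exists_forall_lt_ratio (M : ℝ) :
    ∃ ρ, T.circumradius < ρ ∧ ∀ i, M < T.ratio i ρ := by
  -- If a ratio stayed below N, the left side of `ratio_eq` would be at most B, while ρ² − r²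
  -- exceeds B for ρ = r + B + 1.
  set N := |M| + 1
  have hN : 0 < N := by positivity
  set B := ∑ i, (‖T.baryGrad i‖ ^ 2 * N ^ 2 / 4 + |T.bary i T.circumcenter| * N)
  have hB : ∀ i, ‖T.baryGrad i‖ ^ 2 * N ^ 2 / 4 + |T.bary i T.circumcenter| * N ≤ B := fun i =>
    Finset.single_le_sum
      (f := fun i => ‖T.baryGrad i‖ ^ 2 * N ^ 2 / 4 + |T.bary i T.circumcenter| * N)
      (fun j _ => by positivity) (Finset.mem_univ i)
  have hB0 : 0 ≤ B := Finset.sum_nonneg fun j _ => by positivity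
  have hr := T.circumradius_pos
  have hρ : T.circumradius < T.circumradius + B + 1 := by linarith
  refine ⟨_, hρ, fun i => ?_⟩
  by_contra! hM
  have h1 := ratio_eq hρ.le i
  have h2 := ratio_pos hρ i
  have h3 : T.ratio i (T.circumradius + B + 1) ≤ N := by
    have := le_abs_self M; linarith
  set k := T.ratio i (T.circumradius + B + 1)
  have h4 : ‖T.baryGrad i‖ ^ 2 * k ^ 2 / 4 ≤ ‖T.baryGrad i‖ ^ 2 * N ^ 2 / 4 := by gcongr
  have h5 : -(T.bary i T.circumcenter * k) ≤ |T.bary i T.circumcenter| * N := by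
    calc -(T.bary i T.circumcenter * k) ≤ |T.bary i T.circumcenter| * k := by
          have := neg_abs_le (T.bary i T.circumcenter); nlinarith
      _ ≤ _ := by gcongr
  have h6 := hB i
  nlinarith

lemma norm_sub_faceCenter_sq (hρ : T.circumradius ≤ ρ) (i : Fin 4) (y : E3) :
    ‖y - T.faceCenter ρ i‖ ^ 2 = ρ ^ 2 - T.power y + T.ratio i ρ * T.bary i y := by
  have h := ratio_eq hρ i
  have hy := T.bary_eq_add i T.circumcenter y
  have : y - T.faceCenter ρ i = (y - T.circumcenter) + (T.ratio i ρ / 2) • T.baryGrad i := by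
    rw [faceCenter]; abel
  rw [this, norm_add_sq_real, real_inner_smul_right, norm_smul, mul_pow, Real.norm_eq_abs, sq_abs,
    real_inner_comm, power]
  linear_combination h - T.ratio i ρ * hy

lemma mem_ball_faceCenter (hρ : T.circumradius ≤ ρ) (i : Fin 4) {y : E3} :
    y ∈ ball (T.faceCenter ρ i) ρ ↔ T.ratio i ρ * T.bary i y < T.power y := by
  have h0 : 0 ≤ ρ := T.circumradius_nonneg.trans hρ
  rw [mem_ball, dist_eq_norm, ← sq_lt_sq₀ (norm_nonneg _) h0, norm_sub_faceCenter_sq hρ]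
  constructor <;> intro <;> linarith

lemma mem_sphere_faceCenter (hρ : T.circumradius ≤ ρ) (i : Fin 4) {y : E3} :
    y ∈ sphere (T.faceCenter ρ i) ρ ↔ T.power y = T.ratio i ρ * T.bary i y := by
  have h0 : 0 ≤ ρ := T.circumradius_nonneg.trans hρ
  rw [mem_sphere, dist_eq_norm, ← sq_eq_sq₀ (norm_nonneg _) h0, norm_sub_faceCenter_sq hρ]
  constructor <;> intro <;> linarith

lemma ball_faceCenter_inter (hρ : T.circumradius ≤ ρ) (i : Fin 4) :
    ball (T.faceCenter ρ i) ρ ∩ vertexSet T = ∅ := by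
  rw [eq_empty_iff_forall_notMem]
  rintro _ ⟨h, j, rfl⟩
  rw [mem_ball_faceCenter hρ, power_point, bary_point] at h
  have := ratio_nonneg hρ i
  split_ifs at h <;> linarith

/-- A ball of radius `ρ` is determined by the powers `a` of the vertices. -/
lemma ball_eq_of_powers {a : Fin 4 → ℝ} {c : E3}
    (ha : ∀ i, ‖T.points i - c‖ ^ 2 - ρ ^ 2 = a i) :
    c = T.circumcenter - (1 / 2 : ℝ) • ∑ i, a i • T.baryGrad i ∧
    ‖∑ i, a i • T.baryGrad i‖ ^ 2 / 4 - ∑ i, a i * T.bary i T.circumcenter =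
      ρ ^ 2 - T.circumradius ^ 2 ∧
    ∀ y, ‖y - c‖ ^ 2 = ρ ^ 2 - T.power y + ∑ i, a i * T.bary i y := by
  set O := T.circumcenter with hO
  have hexp : ∀ y, ‖y - c‖ ^ 2 = ‖y - O‖ ^ 2 + ‖c - O‖ ^ 2 - 2 * ⟪c - O, y - O⟫ := by
    intro y
    rw [← sub_sub_sub_cancel_right y c O, norm_sub_sq_real, real_inner_comm]; ring
  have h := T.eq_sum_baryGrad a ((-2 : ℝ) • (c - O)) O
    (‖c - O‖ ^ 2 + T.circumradius ^ 2 - ρ ^ 2) (fun i => by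
      rw [← ha, hexp, hO, norm_point_sub, real_inner_smul_left]; ring)
  obtain ⟨h1, h2⟩ := h
  refine ⟨?_, ?_, fun y => ?_⟩
  · rw [← h1, smul_smul]; norm_num
  · rw [← h1, norm_smul, mul_pow, ← h2]; norm_num; ring
  · have : ∑ i, a i * T.bary i y = ∑ i, a i * T.bary i O + ⟪∑ i, a i • T.baryGrad i, y - O⟫ := by
      simp only [T.bary_eq_add _ O y, mul_add, Finset.sum_add_distrib, sum_inner,
        real_inner_smul_left]
    rw [this, ← h1, ← h2, hexp, real_inner_smul_left, power]; ring

lemma isFaceCenter_iff (hρ : T.circumradius < ρ) (i : Fin 4) (p : E3) :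
    IsFaceCenter T i ρ p ↔ p = T.faceCenter ρ i := by
  have h0 : 0 ≤ ρ := T.circumradius_nonneg.trans hρ.le
  constructor
  · rintro ⟨h1, h2⟩
    set k := ‖T.points i - p‖ ^ 2 - ρ ^ 2
    have hk : 0 ≤ k := by
      rw [mem_ball, not_lt, dist_eq_norm] at h2
      exact sub_nonneg.2 (pow_le_pow_left₀ h0 h2 2)
    obtain ⟨h3, h4, -⟩ := ball_eq_of_powers (T := T) (c := p) (ρ := ρ)
      (a := fun j => if j = i then k else 0) (fun j => by
        by_cases hj : j = i
        · subst hj; simp [k]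
        · have := h1 j hj
          rw [mem_sphere, dist_eq_norm] at this
          simp [hj, this])
    simp only [ite_smul, zero_smul, ite_mul, zero_mul, Finset.sum_ite_eq', Finset.mem_univ,
      if_true] at h3 h4
    rw [norm_smul, mul_pow, Real.norm_eq_abs, sq_abs] at h4
    have := eq_ratio hρ i hk (by linarith)
    rw [h3, faceCenter, ← this, smul_smul]; congr 2; ring
  · rintro rfl
    refine ⟨fun j hj => ?_, ?_⟩
    · rw [mem_sphere_faceCenter hρ.le, power_point, T.bary_point_ne hj.symm, mul_zero]
    · rw [mem_ball_faceCenter hρ.le, power_point, bary_point_self]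
      linarith [ratio_pos hρ i]

/-! ### Hulloids, and points excluded from them -/

lemma mem_hulloid {E : Set E3} {x : E3} :
    x ∈ hulloid ρ E ↔ ∀ c, ball c ρ ∩ E = ∅ → x ∉ ball c ρ := by
  simp [hulloid]

lemma subset_hulloid (E : Set E3) : E ⊆ hulloid ρ E := fun x hx =>
  mem_hulloid.2 fun c hc hxc => by
    have : x ∈ ball c ρ ∩ E := ⟨hxc, hx⟩
    simp [hc] at this

lemma ball_inter_vertexSet {c : E3} :
    ball c ρ ∩ vertexSet T = ∅ ↔ ∀ i, ρ ≤ ‖T.points i - c‖ := by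
  rw [eq_empty_iff_forall_notMem]
  constructor
  · intro h i
    have := h (T.points i)
    by_contra! hi
    exact this ⟨by rwa [mem_ball, dist_eq_norm], i, rfl⟩
  · rintro h _ ⟨h1, i, rfl⟩
    rw [mem_ball, dist_eq_norm] at h1
    exact absurd (h i) (not_le.2 h1)

/-- The homothety with centre x and factor ρ / ρ' carries a ball of radius ρ' containing x to a
smaller ball of radius ρ inside it, still containing x. -/
lemma hulloid_mono {ρ' : ℝ} (h0 : 0 < ρ) (h : ρ ≤ ρ') (E : Set E3) :
    hulloid ρ E ⊆ hulloid ρ' E := by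
  intro x hx
  rw [mem_hulloid] at *
  intro c hc hxc
  rw [mem_ball'] at hxc
  have h0' : 0 < ρ' := h0.trans_le h
  set c' := x + (ρ / ρ') • (c - x) with hc'
  have hd : dist c' x = ρ / ρ' * dist c x := by
    rw [dist_eq_norm, hc', add_sub_cancel_left, norm_smul, Real.norm_of_nonneg (by positivity),
      dist_eq_norm]
  have hd' : dist c' c = (1 - ρ / ρ') * dist c x := by
    have : c' - c = (1 - ρ / ρ') • (x - c) := by rw [hc']; module
    rw [dist_eq_norm, this, norm_smul, Real.norm_of_nonneg, ← dist_eq_norm, dist_comm]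
    exact sub_nonneg.2 ((div_le_one h0').2 h)
  refine hx c' ?_ ?_
  · refine subset_empty_iff.1 (hc ▸ inter_subset_inter_left _ (ball_subset_ball' ?_))
    rw [hd']
    have : (1 - ρ / ρ') * dist c x ≤ (1 - ρ / ρ') * ρ' :=
      mul_le_mul_of_nonneg_left hxc.le (sub_nonneg.2 ((div_le_one h0').2 h))
    have h3 : (1 - ρ / ρ') * ρ' = ρ' - ρ := by field_simp
    linarith
  · rw [mem_ball', hd]
    calc ρ / ρ' * dist c x < ρ / ρ' * ρ' := by gcongr
      _ = ρ := by field_simp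

/-- If a sphere of radius `ρ` through `x` has all vertices strictly outside, then `x` is not in the
hulloid. -/
lemma notMem_hulloid_of_norm_lt (h0 : 0 < ρ) {x u : E3} (hu : ‖u‖ = ρ)
    (h : ∀ i, ρ < ‖T.points i - (x + u)‖) : x ∉ hulloid ρ (vertexSet T) := by
  -- Moving the centre slightly towards x puts x inside the open ball, and the finitely many strict
  -- inequalities survive.
  have hev : ∀ᶠ t : ℝ in nhdsWithin 1 (Iio 1), ∀ i, ρ < ‖T.points i - (x + t • u)‖ := by
    refine Filter.eventually_all.2 fun i => ?_
    have hc : Continuous fun t : ℝ => ‖T.points i - (x + t • u)‖ := by fun_prop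
    exact (hc.continuousAt.eventually_const_lt (by simpa using h i)).filter_mono
      nhdsWithin_le_nhds
  have h2 : ∀ᶠ t : ℝ in nhdsWithin 1 (Iio 1), t ∈ Ioo (0 : ℝ) 1 :=
    Ioo_mem_nhdsLT one_pos
  obtain ⟨t, ht, ht1⟩ := (hev.and h2).exists
  intro hx
  refine mem_hulloid.1 hx (x + t • u) (ball_inter_vertexSet.2 fun i => (ht i).le) ?_
  rw [mem_ball', dist_eq_norm, add_sub_cancel_left, norm_smul, hu, Real.norm_of_nonneg ht1.1.le]
  nlinarith [ht1.2]

lemma power_pos_of_mem_hulloid (h0 : 0 < ρ) {x : E3} (hx : x ∈ hulloid ρ (vertexSet T))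
    (hV : x ∉ vertexSet T) : 0 < T.power x := by
  by_contra! hP
  have hr := T.circumradius_pos
  have hD : T.circumradius ≤ ‖x - T.circumcenter‖ := by
    rw [power] at hP
    exact (sq_le_sq₀ T.circumradius_nonneg (norm_nonneg _)).1 (by linarith)
  set D := ‖x - T.circumcenter‖
  have hD0 : 0 < D := hr.trans_le hD
  -- The ball touches at x, from outside, the sphere about O through x. That sphere encloses the
  -- circumball, and x is not a vertex.
  refine notMem_hulloid_of_norm_lt h0 (x := x) (u := (ρ / D) • (x - T.circumcenter)) ?_ ?_ hx
  · rw [norm_smul, Real.norm_of_nonneg (by positivity)]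
    change ρ / D * D = ρ
    field_simp
  · intro i
    have e1 : T.points i - (x + (ρ / D) • (x - T.circumcenter)) =
        (T.points i - T.circumcenter) - (1 + ρ / D) • (x - T.circumcenter) := by module
    have hw := T.norm_point_sub i
    have hne : T.points i - T.circumcenter ≠ x - T.circumcenter := fun h =>
      hV ⟨i, sub_left_injective h⟩
    have e2 : ‖(T.points i - T.circumcenter) - (x - T.circumcenter)‖ ^ 2 > 0 :=
      pow_pos (norm_pos_iff.2 (sub_ne_zero.2 hne)) 2
    rw [norm_sub_sq_real, hw] at e2
    rw [e1]
    refine lt_of_pow_lt_pow_left₀ 2 (norm_nonneg _) ?_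
    rw [norm_sub_sq_real, hw, real_inner_smul_right, norm_smul,
      Real.norm_of_nonneg (by positivity), mul_pow]
    change 0 < T.circumradius ^ 2 - 2 * ⟪T.points i - T.circumcenter, x - T.circumcenter⟫ + D ^ 2
      at e2
    change _ < T.circumradius ^ 2 - 2 * ((1 + ρ / D) *
      ⟪T.points i - T.circumcenter, x - T.circumcenter⟫) + (1 + ρ / D) ^ 2 * D ^ 2
    set s := ⟪T.points i - T.circumcenter, x - T.circumcenter⟫
    have e3 : (1 + ρ / D) ^ 2 * D ^ 2 = (D + ρ) ^ 2 := by field_simp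
    have e4 : (1 + ρ / D) * (T.circumradius ^ 2 - 2 * s + D ^ 2) > 0 := by positivity
    have e5 : (1 + ρ / D) * (T.circumradius ^ 2 + D ^ 2) =
        T.circumradius ^ 2 + D ^ 2 + ρ * D + ρ * T.circumradius ^ 2 / D := by
      field_simp; ring
    have e6 : T.circumradius ^ 2 / D ≤ D := by
      rw [div_le_iff₀ hD0]; nlinarith
    have e7 : ρ * T.circumradius ^ 2 / D ≤ ρ * D := by
      rw [mul_div_assoc]; gcongr
    rw [e3]
    nlinarith

/-- Avoiding the i-th face ball gives the second inequality; with P > 0 it yields the first. The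
case ρ = r is included for `hulloid_circumradius`. -/
lemma bary_pos_of_mem_hulloid (hρ : T.circumradius ≤ ρ) {x : E3}
    (hx : x ∈ hulloid ρ (vertexSet T)) (hV : x ∉ vertexSet T) (i : Fin 4) :
    0 < T.bary i x ∧ T.power x ≤ T.ratio i ρ * T.bary i x := by
  have h0 := T.circumradius_pos.trans_le hρ
  have hP := power_pos_of_mem_hulloid h0 hx hV
  have h1 := mem_hulloid.1 hx _ (ball_faceCenter_inter hρ i)
  rw [mem_ball_faceCenter hρ, not_lt] at h1
  have h2 := ratio_nonneg hρ i
  exact ⟨pos_of_mul_pos_right (hP.trans_le h1) h2, h1⟩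

/-! ### The hulloid beyond the circumradius: vertices and core -/

variable (T) in
/-- The points of the open circumball outside all the balls through faces. -/
def core (ρ : ℝ) : Set E3 :=
  {x | 0 < T.power x ∧ ∀ i, T.power x ≤ T.ratio i ρ * T.bary i x}

lemma bary_pos_of_mem_core (hρ : T.circumradius ≤ ρ) {x : E3} (hx : x ∈ T.core ρ) (i : Fin 4) :
    0 < T.bary i x :=
  pos_of_mul_pos_right (hx.1.trans_le (hx.2 i)) (ratio_nonneg hρ i)

lemma innerPart_eq_core (hρ : T.circumradius ≤ ρ) :
    innerPart T (T.faceCenter ρ) ρ = T.core ρ := by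
  ext x
  simp only [innerPart, mem_sdiff, mem_interior_solid, mem_iUnion, mem_ball_faceCenter hρ,
    not_exists, not_lt]
  exact ⟨fun h => ⟨T.power_pos h.1, h.2⟩, fun h => ⟨bary_pos_of_mem_core hρ h, h.2⟩⟩

lemma hulloid_subset (hρ : T.circumradius ≤ ρ) :
    hulloid ρ (vertexSet T) ⊆ vertexSet T ∪ T.core ρ := by
  intro x hx
  by_cases hV : x ∈ vertexSet T
  · exact Or.inl hV
  · exact Or.inr ⟨power_pos_of_mem_hulloid (T.circumradius_pos.trans_le hρ) hx hV,
      fun i => (bary_pos_of_mem_hulloid hρ hx hV i).2⟩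

lemma one_le_sum_div_ratio (hρ : T.circumradius < ρ) {a : Fin 4 → ℝ} (ha : ∀ i, 0 ≤ a i)
    (h : ‖∑ i, a i • T.baryGrad i‖ ^ 2 / 4 - ∑ i, a i * T.bary i T.circumcenter =
      ρ ^ 2 - T.circumradius ^ 2) : 1 ≤ ∑ i, a i / T.ratio i ρ := by
  by_contra! hlt
  have hpos := fun i => ratio_pos hρ i
  have hnn : ∀ i, 0 ≤ a i / T.ratio i ρ := fun i => div_nonneg (ha i) (hpos i).le
  have e : ∀ i, a i = a i / T.ratio i ρ * T.ratio i ρ := fun i => by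
    have := (hpos i).ne'; field_simp
  set t := fun i => a i / T.ratio i ρ with ht
  have h1 : ‖∑ i, a i • T.baryGrad i‖ ^ 2 ≤ ∑ i, t i * (T.ratio i ρ * ‖T.baryGrad i‖) ^ 2 := by
    have h2 : ‖∑ i, a i • T.baryGrad i‖ ≤ ∑ i, t i * (T.ratio i ρ * ‖T.baryGrad i‖) := by
      refine (norm_sum_le _ _).trans_eq (Finset.sum_congr rfl fun i _ => ?_)
      rw [norm_smul, Real.norm_of_nonneg (ha i)]
      nth_rewrite 1 [e i]; simp only [ht]; ring
    -- Cauchy–Schwarz with weights `t i`, whose sum is below 1 by assumption. Summing `ratio_eq`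
    -- with the same weights then keeps the quadratic strictly below ρ² − r².
    have h3 : (∑ i, t i * (T.ratio i ρ * ‖T.baryGrad i‖)) ^ 2 ≤
        (∑ i, t i) * ∑ i, t i * (T.ratio i ρ * ‖T.baryGrad i‖) ^ 2 := by
      refine Finset.sum_sq_le_sum_mul_sum_of_sq_le_mul _ (fun i _ => hnn i)
        (fun i _ => mul_nonneg (hnn i) (sq_nonneg _)) fun i _ => le_of_eq (by ring)
    have h4 : 0 ≤ ∑ i, t i * (T.ratio i ρ * ‖T.baryGrad i‖) ^ 2 :=
      Finset.sum_nonneg fun i _ => mul_nonneg (hnn i) (sq_nonneg _)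
    calc _ ≤ _ := pow_le_pow_left₀ (norm_nonneg _) h2 2
      _ ≤ _ := h3
      _ ≤ _ := by nlinarith
  have h5 : (∑ i, t i * (T.ratio i ρ * ‖T.baryGrad i‖) ^ 2) / 4 -
      ∑ i, a i * T.bary i T.circumcenter = (∑ i, t i) * (ρ ^ 2 - T.circumradius ^ 2) := by
    rw [Finset.sum_div, ← Finset.sum_sub_distrib, Finset.sum_mul]
    refine Finset.sum_congr rfl fun i _ => ?_
    nth_rewrite 1 [e i]
    rw [← ratio_eq hρ.le i]; simp only [ht]; ring
  have := sq_sub_pos hρ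
  nlinarith

lemma hulloid_eq (hρ : T.circumradius < ρ) :
    hulloid ρ (vertexSet T) = vertexSet T ∪ T.core ρ := by
  refine (hulloid_subset hρ.le).antisymm (union_subset (subset_hulloid _) fun x hx => ?_)
  rw [mem_hulloid]
  intro c hc hxc
  rw [ball_inter_vertexSet] at hc
  have h0 := T.circumradius_pos.trans hρ
  obtain ⟨-, h1, h2⟩ := ball_eq_of_powers (T := T) (c := c) (ρ := ρ) fun i => rfl
  have ha : ∀ i, 0 ≤ ‖T.points i - c‖ ^ 2 - ρ ^ 2 := fun i =>
    sub_nonneg.2 (pow_le_pow_left₀ h0.le (hc i) 2)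
  have h3 := one_le_sum_div_ratio hρ ha h1
  have h4 := h2 x
  rw [mem_ball, dist_eq_norm] at hxc
  have h5 : ‖x - c‖ ^ 2 < ρ ^ 2 := pow_lt_pow_left₀ hxc (norm_nonneg _) two_ne_zero
  have h6 : (∑ i, (‖T.points i - c‖ ^ 2 - ρ ^ 2) / T.ratio i ρ) * T.power x ≤
      ∑ i, (‖T.points i - c‖ ^ 2 - ρ ^ 2) * T.bary i x := by
    rw [Finset.sum_mul]
    refine Finset.sum_le_sum fun i _ => ?_
    have hp := ratio_pos hρ i
    rw [div_mul_eq_mul_div, mul_div_assoc]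
    refine mul_le_mul_of_nonneg_left ?_ (ha i)
    rw [div_le_iff₀ hp, mul_comm]; exact hx.2 i
  nlinarith [hx.1]

end Affine.Simplex

/-! ### Covering a unit circle by three discs through a point -/

/-- Dot product in the coordinate plane. -/
def dot2 (a b : ℝ × ℝ) : ℝ := a.1 * b.1 + a.2 * b.2

/-- `p` lies in the closed disc centred at `w` whose boundary passes through the origin. -/
def Covers (w p : ℝ × ℝ) : Prop := dot2 p p ≤ 2 * dot2 p w

/-- The hypothesis `hσ` says |u + v + t| < 1 for unit vectors, which excludes u = −v. -/
lemma one_add_dot_pos {u1 u2 v1 v2 t1 t2 : ℝ} (hu : u1 * u1 + u2 * u2 = 1)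
    (hv : v1 * v1 + v2 * v2 = 1) (ht : t1 * t1 + t2 * t2 = 1)
    (hσ : 1 + (u1 * v1 + u2 * v2) + (u1 * t1 + u2 * t2) + (v1 * t1 + v2 * t2) < 0) :
    0 < 1 + (u1 * v1 + u2 * v2) := by
  have h1 : 2 * (1 + (u1 * v1 + u2 * v2)) = (u1 + v1) ^ 2 + (u2 + v2) ^ 2 := by
    linear_combination -hu - hv
  have h2 : (u1 * t1 + u2 * t2 + (v1 * t1 + v2 * t2)) ^ 2 ≤ 2 * (1 + (u1 * v1 + u2 * v2)) := by
    have : 2 * (1 + (u1 * v1 + u2 * v2)) = (u1 * t1 + u2 * t2 + (v1 * t1 + v2 * t2)) ^ 2 +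
        (t1 * (u2 + v2) - t2 * (u1 + v1)) ^ 2 := by
      rw [h1]; linear_combination -((u1 + v1) ^ 2 + (u2 + v2) ^ 2) * ht
    have := sq_nonneg (t1 * (u2 + v2) - t2 * (u1 + v1))
    linarith
  have h3 : 0 ≤ 1 + (u1 * v1 + u2 * v2) := by
    have := sq_nonneg (u1 * t1 + u2 * t2 + (v1 * t1 + v2 * t2)); linarith
  refine h3.lt_of_ne fun h => ?_
  rw [← h, mul_zero] at h2
  have := pow_eq_zero_iff two_ne_zero |>.1 (le_antisymm h2 (sq_nonneg _))
  linarith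

/-- A disc through the origin of radius at most one that covers two of three points of the unit
circle about `x`, taken such that the corresponding unit vectors sum to `-x`, is the unit disc
determined by them. -/
lemma Covers.eq_neg {x u v t w : ℝ × ℝ} (hx : dot2 x x < 1) (hu : dot2 u u = 1)
    (hv : dot2 v v = 1) (ht : dot2 t t = 1) (hsum : u + v + t = -x) (hw : dot2 w w ≤ 1)
    (h1 : Covers w (x + u)) (h2 : Covers w (x + t)) : w = -v := by
  obtain rfl : x = -(u + v + t) := by rw [hsum, neg_neg]
  obtain ⟨u1, u2⟩ := u
  obtain ⟨v1, v2⟩ := v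
  obtain ⟨t1, t2⟩ := t
  obtain ⟨w1, w2⟩ := w
  simp only [dot2, Covers, Prod.mk_add_mk, Prod.neg_mk, Prod.mk.injEq] at *
  have e1 : 0 ≤ -((v1 + t1) * (w1 + v1) + (v2 + t2) * (w2 + v2)) := by
    linear_combination h1 / 2 + hv / 2 - ht / 2
  have e2 : 0 ≤ -((u1 + v1) * (w1 + v1) + (u2 + v2) * (w2 + v2)) := by
    linear_combination h2 / 2 + hv / 2 - hu / 2
  have hσ : 1 + (u1 * v1 + u2 * v2) + (u1 * t1 + u2 * t2) + (v1 * t1 + v2 * t2) < 0 := by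
    linear_combination hx / 2 - hu / 2 - hv / 2 - ht / 2
  have huv := one_add_dot_pos hu hv ht hσ
  have hvt : 0 < 1 + (v1 * t1 + v2 * t2) := one_add_dot_pos hv ht hu (by linarith)
  have hXD : (u1 * v2 - u2 * v1) * ((u1 * v2 - u2 * v1) + (v1 * t2 - v2 * t1) -
      (t1 * u2 - t2 * u1)) = (1 + (u1 * v1 + u2 * v2)) *
      (1 - (u1 * v1 + u2 * v2) + (v1 * t1 + v2 * t2) - (u1 * t1 + u2 * t2)) := by
    linear_combination (v1 * v1 + v2 * v2) * hu + hv - (u1 * t1 + u2 * t2) * hv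
      + (v1 * t1 + v2 * t2) * hu
  have hYD : (v1 * t2 - v2 * t1) * ((u1 * v2 - u2 * v1) + (v1 * t2 - v2 * t1) -
      (t1 * u2 - t2 * u1)) = (1 + (v1 * t1 + v2 * t2)) *
      (1 - (v1 * t1 + v2 * t2) + (u1 * v1 + u2 * v2) - (u1 * t1 + u2 * t2)) := by
    linear_combination (v1 * v1 + v2 * v2) * ht + hv - (u1 * t1 + u2 * t2) * hv
      + (u1 * v1 + u2 * v2) * ht
  -- With `hXD` and `hYD`, this exhibits v as a positive combination of v + t and u + v, so `e1` and
  -- `e2` give v · (w + v) ≤ 0.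
  have f1 : (u1 * v2 - u2 * v1) * (v1 + t1) + (v1 * t2 - v2 * t1) * (u1 + v1) =
    ((u1 * v2 - u2 * v1) + (v1 * t2 - v2 * t1) - (t1 * u2 - t2 * u1)) * v1 := by ring
  have f2 : (u1 * v2 - u2 * v1) * (v2 + t2) + (v1 * t2 - v2 * t1) * (u2 + v2) =
    ((u1 * v2 - u2 * v1) + (v1 * t2 - v2 * t1) - (t1 * u2 - t2 * u1)) * v2 := by ring
  have hXD' := mul_pos huv (show 0 < 1 - (u1 * v1 + u2 * v2) + (v1 * t1 + v2 * t2) -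
    (u1 * t1 + u2 * t2) by linarith)
  have hYD' := mul_pos hvt (show 0 < 1 - (v1 * t1 + v2 * t2) + (u1 * v1 + u2 * v2) -
    (u1 * t1 + u2 * t2) by linarith)
  rw [← hXD] at hXD'
  rw [← hYD] at hYD'
  generalize (u1 * v2 - u2 * v1) + (v1 * t2 - v2 * t1) - (t1 * u2 - t2 * u1) = D at *
  generalize u1 * v2 - u2 * v1 = X at *
  generalize v1 * t2 - v2 * t1 = Y at *
  have hD2 : 0 < D ^ 2 := by
    have : D ≠ 0 := by rintro rfl; simp at hXD'
    positivity
  have e3 : D ^ 2 * (v1 * (w1 + v1) + v2 * (w2 + v2)) ≤ 0 := by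
    have : D ^ 2 * (v1 * (w1 + v1) + v2 * (w2 + v2)) =
        -(X * D * -((v1 + t1) * (w1 + v1) + (v2 + t2) * (w2 + v2))
        + Y * D * -((u1 + v1) * (w1 + v1) + (u2 + v2) * (w2 + v2))) := by
      linear_combination -D * (w1 + v1) * f1 - D * (w2 + v2) * f2
    rw [this]
    have := mul_nonneg hXD'.le e1
    have := mul_nonneg hYD'.le e2
    linarith
  have e4 : v1 * (w1 + v1) + v2 * (w2 + v2) ≤ 0 := by
    by_contra! h
    exact absurd (mul_pos hD2 h) (not_lt.2 e3)
  -- |w + v|² = 2 v · (w + v) + |w|² − |v|².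
  have e5 : (w1 + v1) ^ 2 + (w2 + v2) ^ 2 ≤ 0 := by
    linear_combination 2 * e4 + hw - hv
  have g1 := sq_nonneg (w1 + v1)
  have g2 := sq_nonneg (w2 + v2)
  have k1 : w1 + v1 = 0 := pow_eq_zero_iff two_ne_zero |>.1 (by linarith)
  have k2 : w2 + v2 = 0 := pow_eq_zero_iff two_ne_zero |>.1 (by linarith)
  constructor <;> linarith

lemma continuous_dot2 {f g : ℝ → ℝ × ℝ} (hf : Continuous f) (hg : Continuous g) :
    Continuous fun m => dot2 (f m) (g m) := by
  unfold dot2; fun_prop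

/-- If the unit circle about `x` is covered by three discs, the first of which is the unit disc
through the origin centred at `-t`, then an endpoint of the arc cut out by the first disc is
covered by one of the other two. -/
lemma covers_endpoint {x u v t b c : ℝ × ℝ} (hx : dot2 x x < 1) (hu : dot2 u u = 1)
    (hv : dot2 v v = 1) (ht : dot2 t t = 1) (hsum : u + v + t = -x)
    (H : ∀ z, dot2 z z = 1 → Covers (-t) (x + z) ∨ Covers b (x + z) ∨ Covers c (x + z)) :
    Covers b (x + u) ∨ Covers c (x + u) := by
  by_contra! hcon
  obtain ⟨hb, hc⟩ := hcon
  set X := u.1 * v.2 - u.2 * v.1 with hX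
  -- Rational parametrization of the unit circle starting at u. The factor X = u × v makes positive
  -- e rotate away from v, hence out of the disc about −t; the discs b and c are closed, so they
  -- also miss all points near x + u.
  set z : ℝ → ℝ × ℝ := fun e => ((1 + (e * X) ^ 2)⁻¹ * ((1 - (e * X) ^ 2) * u.1 + 2 * (e * X) * u.2),
    (1 + (e * X) ^ 2)⁻¹ * ((1 - (e * X) ^ 2) * u.2 - 2 * (e * X) * u.1)) with hz
  have hpos : ∀ e, 0 < 1 + (e * X) ^ 2 := fun e => by positivity
  have hz1 : ∀ e, dot2 (z e) (z e) = 1 := by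
    intro e
    have := (hpos e).ne'
    simp only [dot2, hz] at *
    field_simp
    linear_combination (1 + (e * X) ^ 2) ^ 2 * hu
  have hzc : Continuous z := by
    have : ∀ e, 1 + (e * X) ^ 2 ≠ 0 := fun e => (hpos e).ne'
    fun_prop (disch := assumption)
  have hz0 : z 0 = u := by simp [hz]
  have hev : ∀ w, ¬ Covers w (x + u) → ∀ᶠ e in nhdsWithin (0 : ℝ) (Ioi 0),
      ¬ Covers w (x + z e) := by
    intro w hw
    simp only [Covers, not_le] at *
    have h1 : Continuous fun e => 2 * dot2 (x + z e) w :=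
      (continuous_dot2 (hzc.const_add x) continuous_const).const_mul 2
    have h2 : Continuous fun e => dot2 (x + z e) (x + z e) :=
      continuous_dot2 (hzc.const_add x) (hzc.const_add x)
    exact ((h1.tendsto 0).eventually_lt (h2.tendsto 0) (by simpa [hz0] using hw)).filter_mono
      nhdsWithin_le_nhds
  obtain ⟨e, ⟨⟨he1, he2⟩, he3⟩⟩ := (((hev b hb).and (hev c hc)).and
    (self_mem_nhdsWithin (a := (0 : ℝ)) (s := Ioi 0))).exists
  have he : 0 < e := he3
  have hcov : Covers (-t) (x + z e) := ((H _ (hz1 e)).resolve_right (by tauto))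
  have hze := hz1 e
  have d1 := hpos e
  obtain rfl : x = -(u + v + t) := by rw [hsum, neg_neg]
  have hσ : 1 + (u.1 * v.1 + u.2 * v.2) + (u.1 * t.1 + u.2 * t.2) + (v.1 * t.1 + v.2 * t.2) < 0 := by
    simp only [dot2, Prod.fst_add, Prod.snd_add, Prod.fst_neg, Prod.snd_neg] at *
    linear_combination hx / 2 - hu / 2 - hv / 2 - ht / 2
  have huv := one_add_dot_pos hu hv ht hσ
  have hut := one_add_dot_pos hu ht hv (by linarith)
  have hX0 : X ≠ 0 := by
    intro h0
    have h1 : (1 + (u.1 * v.1 + u.2 * v.2)) * (1 - (u.1 * v.1 + u.2 * v.2)) = 0 := by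
      have : X ^ 2 = (1 + (u.1 * v.1 + u.2 * v.2)) * (1 - (u.1 * v.1 + u.2 * v.2)) := by
        simp only [dot2] at hu hv
        rw [hX]; linear_combination (v.1 * v.1 + v.2 * v.2) * hu + hv
      rw [← this, h0]; ring
    have h2 := (mul_eq_zero.1 h1).resolve_left huv.ne'
    have hvt : 0 < 1 + (v.1 * t.1 + v.2 * t.2) := one_add_dot_pos hv ht hu (by linarith)
    linarith
  -- As x + t = −(u + v), membership in the disc about −t reads |z − (u + v)| ≤ 1, which is linear
  -- in z on the unit circle.
  have hfin : dot2 (z e) (u + v) ≥ dot2 u (u + v) := by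
    simp only [Covers, dot2, Prod.fst_add, Prod.snd_add, Prod.fst_neg, Prod.snd_neg] at *
    linear_combination hcov / 2 - hze / 2 + hu / 2 - hv / 2 + ht / 2
  have hval : (1 + (e * X) ^ 2) * (dot2 (z e) (u + v) - dot2 u (u + v)) =
      -2 * (e * X) ^ 2 * (1 + (u.1 * v.1 + u.2 * v.2)) - 2 * e * X ^ 2 := by
    have := d1.ne'
    simp only [dot2, Prod.fst_add, Prod.snd_add, hz] at *
    field_simp
    have hXX : X ^ 2 = X * (u.1 * v.2 - u.2 * v.1) := by rw [← hX]; ring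
    linear_combination (-2 * (e * X) ^ 2) * hu - 2 * e * hXX
  have h1 : 0 ≤ (1 + (e * X) ^ 2) * (dot2 (z e) (u + v) - dot2 u (u + v)) :=
    mul_nonneg d1.le (by linarith)
  have h2 : 0 < 2 * e * X ^ 2 := by positivity
  have h3 : 0 ≤ 2 * (e * X) ^ 2 * (1 + (u.1 * v.1 + u.2 * v.2)) := by positivity
  linarith

/-- Lengthening a enlarges the disc through the origin. For a = 0 the disc is only the origin, so
any unit vector serves. -/
lemma exists_unit_covers (a : ℝ × ℝ) (ha : dot2 a a ≤ 1) :
    ∃ a', dot2 a' a' = 1 ∧ ∀ p, 0 < dot2 p p → Covers a p → Covers a' p := by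
  by_cases h0 : dot2 a a = 0
  · refine ⟨(1, 0), by simp [dot2], fun p hp h => ?_⟩
    simp only [Covers, dot2] at *
    have h1 : a.1 = 0 := by nlinarith
    have h2 : a.2 = 0 := by nlinarith
    simp only [h1, h2] at h
    linarith
  · have hpos : 0 < dot2 a a := lt_of_le_of_ne (by unfold dot2; nlinarith) (Ne.symm h0)
    set s := √(dot2 a a)
    have hs : 0 < s := Real.sqrt_pos.2 hpos
    have hs2 : s ^ 2 = dot2 a a := Real.sq_sqrt hpos.le
    have hs1 : 1 ≤ s⁻¹ := (one_le_inv₀ hs).2 (by nlinarith)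
    refine ⟨(s⁻¹ * a.1, s⁻¹ * a.2), ?_, fun p hp h => ?_⟩
    · have : dot2 (s⁻¹ * a.1, s⁻¹ * a.2) (s⁻¹ * a.1, s⁻¹ * a.2) = s⁻¹ ^ 2 * dot2 a a := by
        simp only [dot2]; ring
      rw [this, ← hs2]; field_simp
    · have : dot2 p (s⁻¹ * a.1, s⁻¹ * a.2) = s⁻¹ * dot2 p a := by simp only [dot2]; ring
      unfold Covers at *
      rw [this]
      nlinarith

lemma exists_unit_add_eq {a x : ℝ × ℝ} (ha : dot2 a a = 1) (hx : dot2 x x < 1) :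
    ∃ u v, dot2 u u = 1 ∧ dot2 v v = 1 ∧ u + v = a - x := by
  set q := dot2 (a - x) (a - x) with hq
  have hq0 : 0 < q := by
    by_contra! h
    simp only [hq, dot2, Prod.fst_sub, Prod.snd_sub] at *
    have h1 : a.1 - x.1 = 0 := by nlinarith [sq_nonneg (a.1 - x.1), sq_nonneg (a.2 - x.2)]
    have h2 : a.2 - x.2 = 0 := by nlinarith [sq_nonneg (a.1 - x.1), sq_nonneg (a.2 - x.2)]
    rw [sub_eq_zero] at h1 h2
    rw [h1, h2] at ha
    linarith
  have hq4 : q ≤ 4 := by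
    simp only [hq, dot2, Prod.fst_sub, Prod.snd_sub] at *
    nlinarith [sq_nonneg (a.1 + x.1), sq_nonneg (a.2 + x.2)]
  -- Half of a − x, plus or minus s times its rotation by a right angle, has squared length q / 4 +
  -- s² q; this equals 1 for the s below.
  have hs0 : 0 ≤ (4 - q) / (4 * q) := div_nonneg (by linarith) (by linarith)
  set s := √((4 - q) / (4 * q))
  have hs : s ^ 2 * (4 * q) = 4 - q := by
    rw [Real.sq_sqrt hs0]; field_simp
  have hqe : q = (a.1 - x.1) ^ 2 + (a.2 - x.2) ^ 2 := by
    rw [hq]; simp only [dot2, Prod.fst_sub, Prod.snd_sub]; ring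
  refine ⟨((a.1 - x.1) / 2 + s * (a.2 - x.2), (a.2 - x.2) / 2 - s * (a.1 - x.1)),
    ((a.1 - x.1) / 2 - s * (a.2 - x.2), (a.2 - x.2) / 2 + s * (a.1 - x.1)), ?_, ?_, ?_⟩
  · simp only [dot2]; linear_combination hs / 4 - (1 / 4 + s ^ 2) * hqe
  · simp only [dot2]; linear_combination hs / 4 - (1 / 4 + s ^ 2) * hqe
  · ext <;> simp

lemma dot2_neg_neg (a : ℝ × ℝ) : dot2 (-a) (-a) = dot2 a a := by simp [dot2]

/-- Enlarge the first disc to the unit disc about −t, whose circle meets that about x in x + u and x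
+ v. The unit circles about −u, −v, −t and x form Johnson's configuration. Each of x + u, x + v, x +
t must lie in disc b or c, so one of these covers two of them and is rigid by `Covers.eq_neg`. If
that is b, c cannot miss two of the points, by `covers_endpoint`. -/
lemma dot2_eq_one_of_covers {a b c x : ℝ × ℝ} (ha : dot2 a a ≤ 1) (hb : dot2 b b ≤ 1)
    (hc : dot2 c c ≤ 1) (hx : dot2 x x < 1)
    (H : ∀ u, dot2 u u = 1 → Covers a (x + u) ∨ Covers b (x + u) ∨ Covers c (x + u)) :
    dot2 c c = 1 := by
  obtain ⟨a', ha', hcov⟩ := exists_unit_covers a ha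
  obtain ⟨u, v, hu, hv, huv⟩ := exists_unit_add_eq ha' hx
  obtain ⟨t, rfl⟩ : ∃ t, a' = -t := ⟨-a', by simp⟩
  have ht : dot2 t t = 1 := by rwa [dot2_neg_neg] at ha'
  have hsum : u + v + t = -x := by rw [huv]; abel
  have H' : ∀ u, dot2 u u = 1 →
      Covers (-t) (x + u) ∨ Covers b (x + u) ∨ Covers c (x + u) := by
    intro u hu
    refine (H u hu).imp_left (hcov _ ?_)
    by_contra! h
    simp only [dot2, Prod.fst_add, Prod.snd_add] at *
    have h1 : x.1 + u.1 = 0 := by nlinarith [sq_nonneg (x.1 + u.1), sq_nonneg (x.2 + u.2)]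
    have h2 : x.2 + u.2 = 0 := by nlinarith [sq_nonneg (x.1 + u.1), sq_nonneg (x.2 + u.2)]
    have : x.1 * x.1 + x.2 * x.2 = u.1 * u.1 + u.2 * u.2 := by
      linear_combination (x.1 - u.1) * h1 + (x.2 - u.2) * h2
    linarith
  have hvut : v + u + t = -x := by rw [← hsum]; abel
  have hutv : u + t + v = -x := by rw [← hsum]; abel
  have htuv : t + u + v = -x := by rw [← hsum]; abel
  have htvu : t + v + u = -x := by rw [← hsum]; abel
  have hvtu : v + t + u = -x := by rw [← hsum]; abel
  have hnt : ¬ Covers (-t) (x + t) := by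
    intro h
    simp only [Covers, dot2, Prod.fst_add, Prod.snd_add, Prod.fst_neg, Prod.snd_neg] at *
    nlinarith [sq_nonneg (x.1 + t.1), sq_nonneg (x.2 + t.2)]
  have pu := covers_endpoint hx hu hv ht hsum H'
  have pv := covers_endpoint hx hv hu ht hvut H'
  have pt := (H' t ht).resolve_left hnt
  have two : ∀ w y z s : ℝ × ℝ, dot2 w w ≤ 1 → dot2 y y = 1 → dot2 z z = 1 → dot2 s s = 1 →
      y + z + s = -x → Covers w (x + y) → Covers w (x + s) → w = -z := fun w y z s hw hy hz hs h =>
    Covers.eq_neg hx hy hz hs h hw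
  have fin : ∀ w, dot2 w w = 1 → c = -w → dot2 c c = 1 := by
    rintro w hw rfl; rwa [dot2_neg_neg]
  by_cases c1 : Covers c (x + u) <;> by_cases c2 : Covers c (x + v) <;>
    by_cases c3 : Covers c (x + t)
  · exact fin _ ht (two c u t v hc hu ht hv hutv c1 c2)
  · exact fin _ ht (two c u t v hc hu ht hv hutv c1 c2)
  · exact fin _ hv (two c u v t hc hu hv ht hsum c1 c3)
  · have hbu := two b v u t hb hv hu ht hvut (pv.resolve_right c2) (pt.resolve_right c3)
    subst hbu
    exact absurd (covers_endpoint (b := -t) (c := c) hx ht hv hu htvu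
      (fun z hz => by have := H' z hz; tauto)) (by tauto)
  · exact fin _ hu (two c v u t hc hv hu ht hvut c2 c3)
  · have hbv := two b u v t hb hu hv ht hsum (pu.resolve_right c1) (pt.resolve_right c3)
    subst hbv
    exact absurd (covers_endpoint (b := -t) (c := c) hx ht hu hv htuv
      (fun z hz => by have := H' z hz; tauto)) (by tauto)
  · have hbt := two b u t v hb hu ht hv hutv (pu.resolve_right c1) (pv.resolve_right c2)
    subst hbt
    exact absurd (covers_endpoint (b := c) (c := c) hx hu hv ht hsum
      (fun z hz => by have := H' z hz; tauto)) (by tauto)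
  · have hbt := two b u t v hb hu ht hv hutv (pu.resolve_right c1) (pv.resolve_right c2)
    subst hbt
    exact absurd (pt.resolve_right c3) hnt

/-! ### Radius equal to the circumradius: reduction to the plane -/

lemma exists_eq_mul_of_mul_nonneg {a b : ℝ} (h : 0 ≤ a * b) :
    (∃ τ ∈ Icc (0 : ℝ) 1, a = τ * b) ∨ ∃ τ ∈ Icc (0 : ℝ) 1, b = τ * a := by
  by_cases ha : a = 0
  · exact Or.inl ⟨0, by simp, by simp [ha]⟩
  by_cases hb : b = 0
  · exact Or.inr ⟨0, by simp, by simp [hb]⟩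
  have h1 : 0 < a / b := by
    have : 0 < a * b := h.lt_of_ne (mul_ne_zero ha hb).symm
    have h2 : a / b = a * b / b ^ 2 := by field_simp
    rw [h2]; positivity
  rcases le_total (a / b) 1 with h2 | h2
  · exact Or.inl ⟨a / b, ⟨h1.le, h2⟩, by field_simp⟩
  · refine Or.inr ⟨b / a, ⟨?_, ?_⟩, by field_simp⟩
    · rw [← inv_div]; positivity
    · rw [← inv_div]; exact inv_le_one_of_one_le₀ h2

/-- Two of any three reals agree in sign, and then one is a multiple of the other by a factor in [0,
1]. -/
lemma exists_ne_eq_mul (y : Fin 4 → ℝ) :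
    ∃ m m', m ≠ m' ∧ ∃ τ ∈ Icc (0 : ℝ) 1, y m = τ * y m' := by
  have key : ∀ i j, i ≠ j → 0 ≤ y i * y j →
      ∃ m m', m ≠ m' ∧ ∃ τ ∈ Icc (0 : ℝ) 1, y m = τ * y m' := by
    intro i j hij h
    rcases exists_eq_mul_of_mul_nonneg h with h | h
    · exact ⟨i, j, hij, h⟩
    · exact ⟨j, i, hij.symm, h⟩
  rcases le_total 0 (y 0) with h0 | h0 <;> rcases le_total 0 (y 1) with h1 | h1 <;>
    rcases le_total 0 (y 2) with h2 | h2
  · exact key 0 1 (by decide) (mul_nonneg h0 h1)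
  · exact key 0 1 (by decide) (mul_nonneg h0 h1)
  · exact key 0 2 (by decide) (mul_nonneg h0 h2)
  · exact key 1 2 (by decide) (mul_nonneg_of_nonpos_of_nonpos h1 h2)
  · exact key 1 2 (by decide) (mul_nonneg h1 h2)
  · exact key 0 2 (by decide) (mul_nonneg_of_nonpos_of_nonpos h0 h2)
  · exact key 0 1 (by decide) (mul_nonneg_of_nonpos_of_nonpos h0 h1)
  · exact key 0 1 (by decide) (mul_nonneg_of_nonpos_of_nonpos h0 h1)

lemma exists_orthonormalBasis_zero {N : E3} (hN : N ≠ 0) :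
    ∃ b : OrthonormalBasis (Fin 3) ℝ E3, N = ‖N‖ • b 0 := by
  have hN' : ‖N‖ ≠ 0 := norm_ne_zero_iff.2 hN
  obtain ⟨b, hb⟩ := Orthonormal.exists_orthonormalBasis_extension_of_card_eq (𝕜 := ℝ) (E := E3)
    (ι := Fin 3) (by simp) (v := fun _ => ‖N‖⁻¹ • N) (s := {0}) (by
      constructor
      · rintro ⟨i, hi⟩; simp [norm_smul, hN']
      · rintro ⟨i, hi⟩ ⟨j, hj⟩ hij
        simp only [mem_singleton_iff] at hi hj
        exact absurd (Subtype.ext (hi.trans hj.symm)) hij)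
  refine ⟨b, ?_⟩
  rw [hb 0 rfl, smul_smul, mul_inv_cancel₀ hN', one_smul]

namespace Affine.Simplex

variable {T : Affine.Simplex ℝ E3 3}

/-- Given a point `x` of the open circumball not on the boundary of the tetrahedron, some sphere
of radius the circumradius through `x` leaves all vertices strictly outside. -/
lemma exists_forall_circumradius_lt {x : E3} (hP : 0 < T.power x) (hb : ∀ i, 0 < T.bary i x) :
    ∃ u : E3, ‖u‖ = T.circumradius ∧ ∀ i, T.circumradius < ‖T.points i - (x + u)‖ := by
  by_contra! H
  have hr := T.circumradius_pos
  set r := T.circumradius with hrdef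
  set y := x - T.circumcenter with hy
  set v : Fin 4 → E3 := fun i => T.points i - T.circumcenter with hv
  have hvn : ∀ i, ‖v i‖ = r := T.norm_point_sub
  have hyr : ‖y‖ ^ 2 < r ^ 2 := by
    have : T.power x = r ^ 2 - ‖y‖ ^ 2 := rfl
    linarith
  have hyr' : ‖y‖ < r := lt_of_pow_lt_pow_left₀ 2 hr.le hyr
  -- Seen from O, the sphere of radius r about y is covered by the closed balls of radius r about
  -- the vertices, all passing through the origin.
  have Hc : ∀ u : E3, ‖u‖ = r → ∃ i, ‖y + u‖ ^ 2 ≤ 2 * ⟪y + u, v i⟫ := by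
    intro u hu
    obtain ⟨i, hi⟩ := H u hu
    refine ⟨i, ?_⟩
    have e : T.points i - (x + u) = v i - (y + u) := by simp only [hv, hy]; abel
    have h2 := pow_le_pow_left₀ (norm_nonneg _) hi 2
    rw [e, norm_sub_sq_real, hvn, real_inner_comm] at h2
    linarith
  -- This makes N orthogonal to y. In the plane orthogonal to N, v m projects to τ times the
  -- projection of v m', so its disc lies in that of m' and only three discs are needed.
  obtain ⟨m, m', hmm, τ, ⟨hτ0, hτ1⟩, hτ⟩ := exists_ne_eq_mul fun i => ⟪v i, y⟫
  set N := v m - τ • v m' with hN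
  have hN0 : N ≠ 0 := by
    intro h
    have h1 : v m = τ • v m' := sub_eq_zero.1 h
    have h2 := congrArg norm h1
    rw [norm_smul, hvn, hvn, Real.norm_of_nonneg hτ0] at h2
    have h3 : τ = 1 := by
      have := hr.ne'
      field_simp at h2
      exact h2.symm
    rw [h3, one_smul] at h1
    exact hmm (T.independent.injective (sub_left_injective h1))
  obtain ⟨b, hNb⟩ := exists_orthonormalBasis_zero hN0
  have hNn : ‖N‖ ≠ 0 := norm_ne_zero_iff.2 hN0
  have hN_inner : ∀ w, ⟪N, w⟫ = ‖N‖ * ⟪b 0, w⟫ := fun w => by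
    nth_rewrite 1 [hNb]; rw [real_inner_smul_left]
  have hNy : ⟪N, y⟫ = 0 := by
    rw [hN, inner_sub_left, real_inner_smul_left]; linarith
  have hby : ⟪b 0, y⟫ = 0 := by
    have := hN_inner y
    rw [hNy] at this
    exact (mul_eq_zero.1 this.symm).resolve_left hNn
  have hsum : ∀ w w' : E3, ⟪b 1, w⟫ * ⟪b 1, w'⟫ + ⟪b 2, w⟫ * ⟪b 2, w'⟫ =
      ⟪w, w'⟫ - ⟪b 0, w⟫ * ⟪b 0, w'⟫ := by
    intro w w'
    have := b.sum_inner_mul_inner w w'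
    rw [Fin.sum_univ_three] at this
    simp only [real_inner_comm w] at this ⊢
    linarith
  set π : E3 → ℝ × ℝ := fun w => (⟪b 1, w⟫ / r, ⟪b 2, w⟫ / r) with hπ
  have hdot : ∀ w w', dot2 (π w) (π w') = (⟪w, w'⟫ - ⟪b 0, w⟫ * ⟪b 0, w'⟫) / r ^ 2 := by
    intro w w'
    rw [← hsum]; simp only [dot2, hπ]; field_simp
  have hdv : ∀ i, dot2 (π (v i)) (π (v i)) ≤ 1 := by
    intro i
    rw [hdot, real_inner_self_eq_norm_sq, hvn, div_le_one (by positivity)]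
    nlinarith [mul_self_nonneg ⟪b 0, v i⟫]
  have hdy : dot2 (π y) (π y) < 1 := by
    rw [hdot, real_inner_self_eq_norm_sq, hby, div_lt_one (by positivity)]
    linarith
  have hcover : ∀ z, dot2 z z = 1 → ∃ k, k ≠ m ∧ Covers (π (v k)) (π y + z) := by
    intro z hz
    set U : E3 := (r * z.1) • b 1 + (r * z.2) • b 2 with hU
    have b01 : ⟪b 0, b 1⟫ = 0 := b.orthonormal.2 (by decide)
    have b02 : ⟪b 0, b 2⟫ = 0 := b.orthonormal.2 (by decide)
    have b12 : ⟪b 1, b 2⟫ = 0 := b.orthonormal.2 (by decide)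
    have b21 : ⟪b 2, b 1⟫ = 0 := b.orthonormal.2 (by decide)
    have h0 : ⟪b 0, U⟫ = 0 := by
      simp [hU, inner_add_right, real_inner_smul_right, b01, b02]
    have h1 : ⟪b 1, U⟫ = r * z.1 := by
      simp [hU, inner_add_right, real_inner_smul_right, b12]
    have h2 : ⟪b 2, U⟫ = r * z.2 := by
      simp [hU, inner_add_right, real_inner_smul_right, b21]
    have hUn : ‖U‖ = r := by
      have h3 := hsum U U
      rw [h0, h1, h2, real_inner_self_eq_norm_sq] at h3
      have h4 : ‖U‖ ^ 2 = r ^ 2 := by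
        simp only [dot2] at hz
        linear_combination r ^ 2 * hz - h3
      exact (sq_eq_sq₀ (norm_nonneg _) hr.le).1 h4
    have hp : π y + z = π (y + U) := by
      simp only [hπ, inner_add_right, h1, h2]
      ext
      · simp only [Prod.fst_add]; field_simp
      · simp only [Prod.snd_add]; field_simp
    have hp0 : ⟪b 0, y + U⟫ = 0 := by rw [inner_add_right, hby, h0, add_zero]
    have hcov : ∀ k, Covers (π (v k)) (π y + z) ↔ ‖y + U‖ ^ 2 ≤ 2 * ⟪y + U, v k⟫ := by
      intro k
      rw [Covers, hp, hdot, hdot, hp0, real_inner_self_eq_norm_sq, zero_mul, zero_mul, sub_zero,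
        sub_zero, ← mul_div_assoc, div_le_div_iff_of_pos_right (by positivity)]
    have hpne : 0 < ‖y + U‖ ^ 2 := by
      refine pow_pos (norm_pos_iff.2 fun h => ?_) 2
      have : U = -y := (neg_eq_of_add_eq_zero_right h).symm
      rw [this, norm_neg] at hUn
      linarith
    obtain ⟨k, hk⟩ := Hc U hUn
    by_cases hkm : k = m
    · refine ⟨m', hmm.symm, (hcov m').2 ?_⟩
      subst hkm
      have h5 : ⟪y + U, v k⟫ = τ * ⟪y + U, v m'⟫ := by
        have : ⟪N, y + U⟫ = 0 := by rw [hN_inner, hp0, mul_zero]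
        rw [hN, inner_sub_left, real_inner_smul_left, real_inner_comm,
          real_inner_comm (y + U) (v m')] at this
        linarith
      have h6 : 0 < τ * ⟪y + U, v m'⟫ := by linarith
      have h7 : 0 < ⟪y + U, v m'⟫ := pos_of_mul_pos_right h6 hτ0
      nlinarith
    · exact ⟨k, hkm, (hcov k).2 hk⟩
  have hcomb : ∀ m k : Fin 4, k ≠ m → ∃ i j, ∀ l, l ≠ m → l = i ∨ l = j ∨ l = k := by decide
  -- The planar result makes each of the three discs a unit disc, so the three vertices other than m
  -- lie in the plane through O orthogonal to N. As x lies there too and λ_m(x) ≠ 0, so does the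
  -- vertex m, which is absurd.
  have hone : ∀ k, k ≠ m → ⟪N, v k⟫ = 0 := by
    intro k hk
    obtain ⟨i, j, hij⟩ := hcomb m k hk
    have h1 := dot2_eq_one_of_covers (hdv i) (hdv j) (hdv k) hdy (fun z hz => by
      obtain ⟨l, hl, hlc⟩ := hcover z hz
      rcases hij l hl with rfl | rfl | rfl
      · exact Or.inl hlc
      · exact Or.inr (Or.inl hlc)
      · exact Or.inr (Or.inr hlc))
    rw [hdot, real_inner_self_eq_norm_sq, hvn, div_eq_one_iff_eq (by positivity)] at h1
    have h2 : ⟪b 0, v k⟫ = 0 := mul_self_eq_zero.1 (by linarith)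
    rw [hN_inner, h2, mul_zero]
  have hexp : ∀ w, ⟪N, w - T.circumcenter⟫ = T.bary m w * ⟪N, v m⟫ := by
    intro w
    nth_rewrite 1 [← T.sum_bary_smul_sub w T.circumcenter]
    rw [inner_sum, Finset.sum_eq_single m]
    · rw [real_inner_smul_right]
    · intro k _ hk
      rw [real_inner_smul_right, hone k hk, mul_zero]
    · simp
  have hm0 : ⟪N, v m⟫ = 0 := by
    have h1 := hexp x
    rw [hNy] at h1
    exact (mul_eq_zero.1 h1.symm).resolve_left (hb m).ne'
  have := hexp (T.circumcenter + N)
  rw [hm0, mul_zero, add_sub_cancel_left] at this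
  exact hN0 (inner_self_eq_zero.1 this)

lemma hulloid_circumradius : hulloid T.circumradius (vertexSet T) = vertexSet T := by
  refine Subset.antisymm (fun x hx => ?_) (subset_hulloid _)
  by_contra hV
  obtain ⟨u, hu, h⟩ := exists_forall_circumradius_lt
    (power_pos_of_mem_hulloid T.circumradius_pos hx hV)
    (fun i => (bary_pos_of_mem_hulloid le_rfl hx hV i).1)
  exact notMem_hulloid_of_norm_lt T.circumradius_pos hu h hx

end Affine.Simplex

lemma IsPreconnected.inter_frontier_nonempty {α : Type*} [TopologicalSpace α] {s A : Set α}
    (hs : IsPreconnected s) (h1 : (s ∩ A).Nonempty) (h2 : (s ∩ Aᶜ).Nonempty) :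
    (s ∩ frontier A).Nonempty := by
  by_contra hcon
  have hd : ∀ x ∈ s, x ∉ frontier A := fun x hx hf => hcon ⟨x, hx, hf⟩
  have hin : ∀ x ∈ s, x ∈ closure A → x ∈ interior A := fun x hx hc => by
    by_contra hi; exact hd x hx ⟨hc, hi⟩
  obtain ⟨x, hx, hxi, hxc⟩ := hs (interior A) (closure A)ᶜ isOpen_interior
    isClosed_closure.isOpen_compl
    (fun x hx => by
      by_cases hc : x ∈ closure A
      · exact Or.inl (hin x hx hc)
      · exact Or.inr hc)
    (h1.imp fun x hx => ⟨hx.1, hin x hx.1 (subset_closure hx.2)⟩)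
    (h2.imp fun x hx => ⟨hx.1, fun hc => hx.2 (interior_subset (hin x hx.1 hc))⟩)
  exact hxc (interior_subset_closure hxi)

/-! ### Parametrization of the core by points of the tetrahedron -/

namespace Affine.Simplex

variable (T : Affine.Simplex ℝ E3 3)

/-- The sum of the reciprocals of the ratios. -/
noncomputable def weight (ρ : ℝ) : ℝ := ∑ i, (T.ratio i ρ)⁻¹

/-- The sum of the vertices, seen from the circumcentre, weighted by the reciprocal ratios. -/
noncomputable def weightVec (ρ : ℝ) : E3 := ∑ i, (T.ratio i ρ)⁻¹ • (T.points i - T.circumcenter)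

/-- The sign of the excess decides whether the core is empty, a point, or a solid. -/
noncomputable def excess (ρ : ℝ) : ℝ :=
  T.weight ρ - (T.circumradius ^ 2 * T.weight ρ ^ 2 - ‖T.weightVec ρ‖ ^ 2)

/-- The linear coefficient of the quadratic equation that defines `scale`. -/
noncomputable def slope (ρ : ℝ) (w : E3) : ℝ :=
  2 * (T.circumradius ^ 2 * T.weight ρ - ⟪T.weightVec ρ, w - T.circumcenter⟫) - 1

/-- The denominator in the solution formula for `scale`. -/
noncomputable def scaleDenom (ρ : ℝ) (w : E3) : ℝ :=
  T.slope ρ w + √(T.slope ρ w ^ 2 + 4 * T.power w * T.excess ρ)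

/-- The positive root `t` of `T.power w * t ^ 2 + T.slope ρ w * t = T.excess ρ`. -/
noncomputable def scale (ρ : ℝ) (w : E3) : ℝ := 2 * T.excess ρ / T.scaleDenom ρ w

/-- The point of the core in the direction of the point `w` of the tetrahedron. -/
noncomputable def corePoint (ρ t : ℝ) (w : E3) : E3 :=
  T.circumcenter + (T.weight ρ + t)⁻¹ • (T.weightVec ρ + t • (w - T.circumcenter))

/-- The points of the tetrahedron that parametrize the core. -/
def coreDomain (ρ : ℝ) : Set E3 := {w | (∀ i, 0 ≤ T.bary i w) ∧ 0 < T.scaleDenom ρ w}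

variable {T} {ρ : ℝ}

lemma weight_pos (hρ : T.circumradius < ρ) : 0 < T.weight ρ :=
  Finset.sum_pos (fun i _ => inv_pos.2 (ratio_pos hρ i)) Finset.univ_nonempty

lemma inner_baryGrad_weightVec (i : Fin 4) :
    ⟪T.baryGrad i, T.weightVec ρ⟫ =
      (T.ratio i ρ)⁻¹ - T.weight ρ * T.bary i T.circumcenter := by
  simp only [weightVec, weight, inner_sum, real_inner_smul_right, inner_baryGrad_sub, mul_sub,
    Finset.sum_sub_distrib, Finset.sum_mul]
  simp

lemma bary_corePoint {t : ℝ} (h : T.weight ρ + t ≠ 0) (i : Fin 4) (w : E3) :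
    T.bary i (T.corePoint ρ t w) =
      (T.weight ρ + t)⁻¹ * ((T.ratio i ρ)⁻¹ + t * T.bary i w) := by
  rw [T.bary_eq_add i T.circumcenter, corePoint, add_sub_cancel_left, real_inner_smul_right,
    inner_add_right, real_inner_smul_right, inner_baryGrad_weightVec,
    T.bary_eq_add i T.circumcenter w]
  field_simp; ring

/-- The quadratic equation for t thus says exactly that the point has power 1 / (weight + t), the
value needed to compare it with `bary_corePoint`. -/
lemma power_corePoint {t : ℝ} (h : T.weight ρ + t ≠ 0) (w : E3) :
    (T.weight ρ + t) ^ 2 * T.power (T.corePoint ρ t w) =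
      T.weight ρ + t + (T.power w * t ^ 2 + T.slope ρ w * t - T.excess ρ) := by
  simp only [power, corePoint, add_sub_cancel_left, slope, excess]
  rw [norm_smul, mul_pow, norm_add_sq_real, norm_smul, mul_pow, real_inner_smul_right]
  simp only [Real.norm_eq_abs, sq_abs]
  field_simp; ring

lemma mem_core_iff (hρ : T.circumradius < ρ) {x : E3} :
    x ∈ T.core ρ ↔ 0 < T.power x ∧ ∀ i, (T.ratio i ρ)⁻¹ * T.power x ≤ T.bary i x := by
  refine and_congr_right fun _ => forall_congr' fun i => ?_
  rw [inv_mul_le_iff₀ (ratio_pos hρ i)]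

/-- Solutions of the quadratic equation give points of the core. -/
lemma corePoint_mem (hρ : T.circumradius < ρ) {t : ℝ} {w : E3} (ht : 0 ≤ t)
    (hw : ∀ i, 0 ≤ T.bary i w)
    (h : T.power w * t ^ 2 + T.slope ρ w * t = T.excess ρ) :
    T.power (T.corePoint ρ t w) = (T.weight ρ + t)⁻¹ ∧ T.corePoint ρ t w ∈ T.core ρ := by
  have hpos : 0 < T.weight ρ + t := add_pos_of_pos_of_nonneg (weight_pos hρ) ht
  have hP : T.power (T.corePoint ρ t w) = (T.weight ρ + t)⁻¹ := by
    have := power_corePoint hpos.ne' (ρ := ρ) (t := t) (T := T) w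
    rw [h, sub_self, add_zero] at this
    field_simp at this ⊢
    linarith
  refine ⟨hP, (mem_core_iff hρ).2 ⟨by rw [hP]; positivity, fun i => ?_⟩⟩
  rw [hP, bary_corePoint hpos.ne', mul_comm]
  refine mul_le_mul_of_nonneg_left ?_ (by positivity)
  linarith [mul_nonneg ht (hw i)]

lemma power_corePoint_eq_iff (hρ : T.circumradius < ρ) {t : ℝ} {w : E3} (ht : 0 < t)
    (h : T.power (T.corePoint ρ t w) = (T.weight ρ + t)⁻¹) (i : Fin 4) :
    T.power (T.corePoint ρ t w) = T.ratio i ρ * T.bary i (T.corePoint ρ t w) ↔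
      T.bary i w = 0 := by
  have hpos : 0 < T.weight ρ + t := add_pos (weight_pos hρ) ht
  have hr := ratio_pos hρ i
  rw [h, bary_corePoint hpos.ne']
  constructor
  · intro h1
    field_simp at h1
    have : T.ratio i ρ * t * T.bary i w = 0 := by linarith
    have h2 : T.ratio i ρ * t ≠ 0 := by positivity
    exact (mul_eq_zero.1 this).resolve_left h2
  · intro h1
    rw [h1]; field_simp; ring

/-- Every point of the core other than the common point of the spheres arises from a solution of
the quadratic equation. -/
lemma exists_corePoint_eq (hρ : T.circumradius < ρ) {x : E3} (hx : x ∈ T.core ρ)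
    (hne : ∃ i, T.power x ≠ T.ratio i ρ * T.bary i x) :
    ∃ t w, 0 < t ∧ (∀ i, 0 ≤ T.bary i w) ∧
      T.power w * t ^ 2 + T.slope ρ w * t = T.excess ρ ∧ T.corePoint ρ t w = x := by
  have hx' := (mem_core_iff hρ).1 hx
  set P := T.power x with hP
  have hP0 : 0 < P := hx.1
  have hl := weight_pos hρ
  set l := T.weight ρ with hldef
  obtain ⟨i₀, hi₀⟩ := hne
  have hlP : l * P < 1 := by
    rw [hldef, weight, Finset.sum_mul, ← T.sum_bary x]
    refine Finset.sum_lt_sum (fun i _ => hx'.2 i) ⟨i₀, Finset.mem_univ _, ?_⟩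
    refine (hx'.2 i₀).lt_of_ne fun h => hi₀ ?_
    rw [← h, mul_inv_cancel_left₀ (ratio_pos hρ i₀).ne']
  -- Forced by summing λ_i / P = 1 / k_i + t λ_i(w) over i.
  set t := P⁻¹ - l with ht
  have ht0 : 0 < t := by
    rw [ht, sub_pos, lt_inv_comm₀ hl hP0, ← one_div, lt_div_iff₀ hl]; linarith
  have hlt : l + t = P⁻¹ := by rw [ht]; ring
  set w := T.circumcenter + t⁻¹ • (P⁻¹ • (x - T.circumcenter) - T.weightVec ρ) with hw
  have hxw : T.corePoint ρ t w = x := by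
    rw [corePoint, hw, add_sub_cancel_left, smul_smul, mul_inv_cancel₀ ht0.ne', one_smul,
      add_sub_cancel, inv_inv, add_sub_cancel, smul_smul, mul_inv_cancel₀ hP0.ne', one_smul,
      add_sub_cancel]
  have hne : T.weight ρ + t ≠ 0 := by rw [← hldef, hlt]; positivity
  refine ⟨t, w, ht0, fun i => ?_, ?_, hxw⟩
  · have h1 := bary_corePoint hne i w
    rw [hxw, ← hldef, hlt, inv_inv] at h1
    have h2 := hx'.2 i
    rw [h1, mul_comm] at h2
    have h3 := le_of_mul_le_mul_left h2 hP0
    exact nonneg_of_mul_nonneg_right (by linarith) ht0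
  · have h1 := power_corePoint hne w
    rw [hxw, ← hldef, hlt, ← hP] at h1
    have : P⁻¹ ^ 2 * P = P⁻¹ := by field_simp
    linarith

/-- If the excess is not positive, then the core contains at most the common point of the
spheres. -/
lemma power_eq_of_excess_nonpos (hρ : T.circumradius < ρ) (hC : T.excess ρ ≤ 0) {x : E3}
    (hx : x ∈ T.core ρ) (i : Fin 4) : T.power x = T.ratio i ρ * T.bary i x := by
  by_contra hne
  obtain ⟨t, w, ht, hw, heq, -⟩ := exists_corePoint_eq hρ hx ⟨i, hne⟩
  have hl := weight_pos hρ
  have hPw := T.power_nonneg hw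
  -- All terms on the right are nonnegative, so the slope is too. Then a root t > 0 makes every term
  -- vanish, which contradicts the positive weight.
  have h1 : T.weight ρ * (T.slope ρ w) = -T.excess ρ + T.weight ρ ^ 2 * T.power w +
      ‖T.weightVec ρ - T.weight ρ • (w - T.circumcenter)‖ ^ 2 := by
    rw [norm_sub_sq_real, norm_smul, mul_pow, real_inner_smul_right, slope, excess, power,
      Real.norm_eq_abs, sq_abs]
    ring
  set n := ‖T.weightVec ρ - T.weight ρ • (w - T.circumcenter)‖ ^ 2 with hn
  have hn0 : 0 ≤ n := sq_nonneg _
  have hs : 0 ≤ T.slope ρ w := by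
    refine nonneg_of_mul_nonneg_right (a := T.weight ρ) ?_ hl
    have : 0 ≤ T.weight ρ ^ 2 * T.power w := by positivity
    linarith
  have hst : T.slope ρ w * t = 0 :=
    le_antisymm (by nlinarith [mul_nonneg hPw (sq_nonneg t)]) (by positivity)
  have hs0 : T.slope ρ w = 0 := (mul_eq_zero.1 hst).resolve_right ht.ne'
  have hPt : T.power w * t ^ 2 = 0 := le_antisymm (by linarith) (by positivity)
  have hP0 : T.power w = 0 := (mul_eq_zero.1 hPt).resolve_right (by positivity)
  rw [hs0, hP0] at h1
  have hn1 : n = 0 := by linarith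
  have hC0 : T.excess ρ = 0 := by linarith
  have hK : T.weightVec ρ = T.weight ρ • (w - T.circumcenter) :=
    sub_eq_zero.1 (norm_eq_zero.1 (pow_eq_zero_iff two_ne_zero |>.1 hn1))
  rw [excess, hK, norm_smul, mul_pow, Real.norm_eq_abs, sq_abs] at hC0
  rw [power] at hP0
  have : T.weight ρ = 0 := by linear_combination hC0 + T.weight ρ ^ 2 * hP0
  exact hl.ne' this

/-- A common point of the four spheres has explicit barycentric coordinates, and exists only if the
excess vanishes. -/
lemma bary_eq_of_forall_power_eq (hρ : T.circumradius < ρ) {x : E3}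
    (h : ∀ i, T.power x = T.ratio i ρ * T.bary i x) :
    (∀ i, T.bary i x = (T.weight ρ)⁻¹ * (T.ratio i ρ)⁻¹) ∧ T.excess ρ = 0 := by
  have hl := weight_pos hρ
  have hl' : T.weight ρ + 0 ≠ 0 := by simpa using hl.ne'
  have hb : ∀ i, T.bary i x = (T.ratio i ρ)⁻¹ * T.power x := fun i => by
    rw [h i, inv_mul_cancel_left₀ (ratio_pos hρ i).ne']
  have h2 : T.weight ρ * T.power x = 1 := by
    rw [weight, Finset.sum_mul, ← T.sum_bary x]
    exact Finset.sum_congr rfl fun i _ => (hb i).symm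
  have hb' : ∀ i, T.bary i x = (T.weight ρ)⁻¹ * (T.ratio i ρ)⁻¹ := fun i => by
    rw [hb, eq_inv_of_mul_eq_one_right h2, mul_comm]
  refine ⟨hb', ?_⟩
  have h3 : x = T.corePoint ρ 0 x := T.bary_ext fun i => by
    rw [bary_corePoint hl', hb', add_zero, zero_mul, add_zero]
  have h4 := power_corePoint (T := T) hl' x
  rw [← h3, add_zero, pow_two, mul_assoc, h2] at h4
  linarith

/-- If the excess vanishes, then the four spheres meet in exactly one point, which is the core. -/
lemma exists_eq_singleton (hρ : T.circumradius < ρ) (hC : T.excess ρ = 0) :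
    ∃ O ∈ interior (solid T), ⋂ i, sphere (T.faceCenter ρ i) ρ = {O} ∧ T.core ρ = {O} := by
  have hl := weight_pos hρ
  set z := T.corePoint ρ 0 T.circumcenter with hz
  have hl' : T.weight ρ + 0 ≠ 0 := by simpa using hl.ne'
  have hPz : T.power z = (T.weight ρ)⁻¹ := by
    have h1 := power_corePoint (T := T) hl' T.circumcenter
    rw [hC, ← hz] at h1
    simp only [add_zero] at h1
    field_simp
    have : T.weight ρ * (T.power z * T.weight ρ) = T.weight ρ * 1 := by linarith
    exact mul_left_cancel₀ hl.ne' this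
  have hbz : ∀ i, T.bary i z = (T.weight ρ)⁻¹ * (T.ratio i ρ)⁻¹ := fun i => by
    rw [hz, bary_corePoint hl']; simp
  have hzeq : ∀ i, T.power z = T.ratio i ρ * T.bary i z := fun i => by
    have := (ratio_pos hρ i).ne'
    rw [hPz, hbz]; field_simp
  have huniq : ∀ x, (∀ i, T.power x = T.ratio i ρ * T.bary i x) → x = z := by
    intro x h1
    exact T.bary_ext fun i => by rw [(bary_eq_of_forall_power_eq hρ h1).1, hbz]
  have hzc : z ∈ T.core ρ := ⟨by rw [hPz]; positivity, fun i => (hzeq i).le⟩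
  refine ⟨z, T.mem_interior_solid.2 (bary_pos_of_mem_core hρ.le hzc), ?_, ?_⟩
  · ext x
    simp only [mem_iInter, mem_sphere_faceCenter hρ.le, mem_singleton_iff]
    exact ⟨huniq x, fun h => h ▸ hzeq⟩
  · ext x
    exact ⟨fun hx => huniq x (power_eq_of_excess_nonpos hρ hC.le hx), fun h => by
      rw [mem_singleton_iff.1 h]; exact hzc⟩

section Quadratic

lemma add_sqrt_pos {b P C : ℝ} (hP : 0 < P) (hC : 0 < C) : 0 < b + √(b ^ 2 + 4 * P * C) := by
  have h : |b| < √(b ^ 2 + 4 * P * C) := by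
    rw [← Real.sqrt_sq_eq_abs]
    exact Real.sqrt_lt_sqrt (sq_nonneg b) (by have := mul_pos hP hC; linarith)
  linarith [neg_abs_le b]

/-- The rationalized root formula remains valid when P = 0, which happens at the vertices. -/
lemma quadratic_root {b P C : ℝ} (hP : 0 ≤ P) (hC : 0 < C) (h : 0 < b + √(b ^ 2 + 4 * P * C)) :
    P * (2 * C / (b + √(b ^ 2 + 4 * P * C))) ^ 2 + b * (2 * C / (b + √(b ^ 2 + 4 * P * C))) = C := by
  have hs : √(b ^ 2 + 4 * P * C) ^ 2 = b ^ 2 + 4 * P * C := Real.sq_sqrt (by positivity)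
  set s := √(b ^ 2 + 4 * P * C)
  have := h.ne'
  field_simp
  linear_combination -hs

lemma eq_quadratic_root {b P C t : ℝ} (hP : 0 ≤ P) (hC : 0 < C) (ht : 0 < t)
    (h : P * t ^ 2 + b * t = C) :
    0 < b + √(b ^ 2 + 4 * P * C) ∧ t = 2 * C / (b + √(b ^ 2 + 4 * P * C)) := by
  have h1 : 0 < b + P * t := by
    refine pos_of_mul_pos_right (a := t) (by nlinarith) ht.le
  have h2 : √(b ^ 2 + 4 * P * C) = b + 2 * P * t := by
    rw [Real.sqrt_eq_iff_mul_self_eq (by positivity) (by nlinarith [mul_nonneg hP ht.le]), ← h]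
    ring
  rw [h2]
  have h3 : b + (b + 2 * P * t) = 2 * (b + P * t) := by ring
  rw [h3]
  refine ⟨by positivity, ?_⟩
  rw [eq_div_iff (by positivity)]
  linarith

end Quadratic

/-- Positive excess rules out a common point of the spheres, so t > 0 throughout and is the unique
positive root. The i-th sphere corresponds to the face λ_i(w) = 0. -/
lemma core_eq_image (hρ : T.circumradius < ρ) (hC : 0 < T.excess ρ) :
    T.core ρ = (fun w => T.corePoint ρ (T.scale ρ w) w) '' T.coreDomain ρ ∧
    ∀ i, {x ∈ T.core ρ | T.power x = T.ratio i ρ * T.bary i x} =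
      (fun w => T.corePoint ρ (T.scale ρ w) w) '' (T.coreDomain ρ ∩ {w | T.bary i w = 0}) := by
  have hne : ∀ x ∈ T.core ρ, ∃ i, T.power x ≠ T.ratio i ρ * T.bary i x := by
    intro x hx
    by_contra! hall
    exact hC.ne' (bary_eq_of_forall_power_eq hρ hall).2
  have hto : ∀ x ∈ T.core ρ, ∃ w ∈ T.coreDomain ρ, T.corePoint ρ (T.scale ρ w) w = x := by
    intro x hx
    obtain ⟨t, w, ht, hw, heq, hxw⟩ := exists_corePoint_eq hρ hx (hne x hx)
    obtain ⟨h1, h2⟩ := eq_quadratic_root (T.power_nonneg hw) hC ht heq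
    have h3 : t = T.scale ρ w := h2
    exact ⟨w, ⟨hw, h1⟩, h3 ▸ hxw⟩
  have hfrom : ∀ w ∈ T.coreDomain ρ, 0 < T.scale ρ w ∧
      T.power (T.corePoint ρ (T.scale ρ w) w) = (T.weight ρ + T.scale ρ w)⁻¹ ∧
      T.corePoint ρ (T.scale ρ w) w ∈ T.core ρ := by
    rintro w ⟨hw, hd⟩
    have hs : 0 < T.scale ρ w := div_pos (by linarith) hd
    exact ⟨hs, corePoint_mem hρ hs.le hw (quadratic_root (T.power_nonneg hw) hC hd)⟩
  constructor
  · ext x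
    refine ⟨hto x, ?_⟩
    rintro ⟨w, hw, rfl⟩
    exact (hfrom w hw).2.2
  · intro i
    ext x
    constructor
    · rintro ⟨hx, hxi⟩
      obtain ⟨w, hw, rfl⟩ := hto x hx
      obtain ⟨h1, h2, -⟩ := hfrom w hw
      exact ⟨w, ⟨hw, (power_corePoint_eq_iff hρ h1 h2 i).1 hxi⟩, rfl⟩
    · rintro ⟨w, ⟨hw, hwi⟩, rfl⟩
      obtain ⟨h1, h2, h3⟩ := hfrom w hw
      exact ⟨h3, (power_corePoint_eq_iff hρ h1 h2 i).2 hwi⟩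

lemma continuousOn_corePoint (hρ : T.circumradius < ρ) (hC : 0 < T.excess ρ) :
    ContinuousOn (fun w => T.corePoint ρ (T.scale ρ w) w) (T.coreDomain ρ) := by
  have hp := T.continuous_power
  have hsl : Continuous (T.slope ρ) := by unfold slope; fun_prop
  have hd : Continuous (T.scaleDenom ρ) := by unfold scaleDenom; fun_prop
  have hs : ContinuousOn (T.scale ρ) (T.coreDomain ρ) :=
    continuousOn_const.div hd.continuousOn fun w hw => hw.2.ne'
  have hl : ∀ w ∈ T.coreDomain ρ, T.weight ρ + T.scale ρ w ≠ 0 := fun w hw =>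
    (add_pos (weight_pos hρ) (div_pos (by linarith) hw.2)).ne'
  unfold corePoint
  exact continuousOn_const.add (((continuousOn_const.add hs).inv₀ hl).smul
    (continuousOn_const.add (hs.smul (continuousOn_id.sub continuousOn_const))))

lemma bary_combo {a b : ℝ} (hab : a + b = 1) (i : Fin 4) (w w' : E3) :
    T.bary i (a • w + b • w') = a * T.bary i w + b * T.bary i w' := by
  have e : a • w + b • w' - T.circumcenter =
      a • (w - T.circumcenter) + b • (w' - T.circumcenter) := by
    have : T.circumcenter = (a + b) • T.circumcenter := by rw [hab, one_smul]
    nth_rewrite 1 [this]; module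
  rw [T.bary_eq_add i T.circumcenter (a • w + b • w'), T.bary_eq_add i T.circumcenter w,
    T.bary_eq_add i T.circumcenter w', e, inner_add_right, real_inner_smul_right,
    real_inner_smul_right]
  linear_combination (-T.bary i T.circumcenter) * hab

lemma power_combo {a b : ℝ} (hab : a + b = 1) (w w' : E3) :
    T.power (a • w + b • w') = a * T.power w + b * T.power w' + a * b * ‖w - w'‖ ^ 2 := by
  have e : a • w + b • w' - T.circumcenter =
      a • (w - T.circumcenter) + b • (w' - T.circumcenter) := by
    have : T.circumcenter = (a + b) • T.circumcenter := by rw [hab, one_smul]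
    nth_rewrite 1 [this]; module
  obtain rfl : b = 1 - a := by linarith
  rw [← sub_sub_sub_cancel_right w w' T.circumcenter]
  simp only [power, e]
  rw [norm_add_sq_real, norm_sub_sq_real (w - T.circumcenter), norm_smul, norm_smul, mul_pow,
    mul_pow, real_inner_smul_left, real_inner_smul_right]
  simp only [Real.norm_eq_abs, sq_abs]
  ring

/-- By strict concavity, P is positive inside any nondegenerate segment in T, and P > 0 makes the
denominator positive. Only vertices can be missing from the domain. -/
lemma convex_coreDomain (hC : 0 < T.excess ρ) : Convex ℝ (T.coreDomain ρ) := by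
  rw [convex_iff_forall_pos]
  intro w hw w' hw' a b ha hb hab
  by_cases hne : w = w'
  · rw [← hne, ← add_smul, hab, one_smul]; exact hw
  · refine ⟨fun i => ?_, add_sqrt_pos ?_ hC⟩
    · rw [bary_combo hab]
      have := mul_nonneg ha.le (hw.1 i)
      have := mul_nonneg hb.le (hw'.1 i)
      linarith
    · rw [power_combo hab]
      have := mul_nonneg ha.le (T.power_nonneg hw.1)
      have := mul_nonneg hb.le (T.power_nonneg hw'.1)
      have : 0 < ‖w - w'‖ := norm_pos_iff.2 (sub_ne_zero.2 hne)
      positivity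

lemma convex_bary_eq_zero (i : Fin 4) : Convex ℝ {w | T.bary i w = 0} := by
  intro w hw w' hw' a b _ _ hab
  simp only [mem_ofPred_eq] at *
  rw [bary_combo hab, hw, hw']; ring

lemma coreDomain_inter_nonempty (hC : 0 < T.excess ρ) (i : Fin 4) :
    (T.coreDomain ρ ∩ {w | T.bary i w = 0}).Nonempty := by
  obtain ⟨j, k, hj, hk, hjk⟩ : ∃ j k : Fin 4, i ≠ j ∧ i ≠ k ∧ j ≠ k := by
    revert i; decide
  have hab : (1 / 2 : ℝ) + 1 / 2 = 1 := by norm_num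
  -- The midpoint of an edge of the i-th face has P > 0.
  refine ⟨(1 / 2 : ℝ) • T.points j + (1 / 2 : ℝ) • T.points k, ⟨fun l => ?_, add_sqrt_pos ?_ hC⟩, ?_⟩
  · rw [bary_combo hab, bary_point, bary_point]
    split_ifs <;> norm_num
  · rw [power_combo hab, power_point, power_point]
    have : 0 < ‖T.points j - T.points k‖ :=
      norm_pos_iff.2 (sub_ne_zero.2 (T.independent.injective.ne hjk))
    positivity
  · rw [mem_ofPred_eq, bary_combo hab, T.bary_point_ne hj, T.bary_point_ne hk]; ring

lemma isConnected_core (hρ : T.circumradius < ρ) (hC : 0 < T.excess ρ) :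
    IsConnected (T.core ρ) := by
  rw [(core_eq_image hρ hC).1]
  exact ⟨((coreDomain_inter_nonempty hC 0).mono inter_subset_left).image _,
    (convex_coreDomain hC).isPreconnected.image _ (continuousOn_corePoint hρ hC)⟩

lemma isConnected_coreFace (hρ : T.circumradius < ρ) (hC : 0 < T.excess ρ) (i : Fin 4) :
    IsConnected {x ∈ T.core ρ | T.power x = T.ratio i ρ * T.bary i x} := by
  rw [(core_eq_image hρ hC).2 i]
  exact ⟨(coreDomain_inter_nonempty hC i).image _,
    ((convex_coreDomain hC).inter (convex_bary_eq_zero i)).isPreconnected.image _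
      ((continuousOn_corePoint hρ hC).mono inter_subset_left)⟩

/-! ### The frontier of the core -/

lemma mem_interior_core {x : E3} (h0 : 0 < T.power x)
    (h : ∀ i, T.power x < T.ratio i ρ * T.bary i x) : x ∈ interior (T.core ρ) := by
  have hp := T.continuous_power
  have hb := fun i => T.continuous_bary i
  have hopen : IsOpen {x | 0 < T.power x ∧ ∀ i, T.power x < T.ratio i ρ * T.bary i x} := by
    simp only [ofPred_and, ofPred_forall]
    exact (isOpen_lt continuous_const hp).inter
      (isOpen_iInter_of_finite fun i => isOpen_lt hp ((hb i).const_mul _))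
  have hsub : {x | 0 < T.power x ∧ ∀ i, T.power x < T.ratio i ρ * T.bary i x} ⊆ T.core ρ :=
    fun y hy => ⟨hy.1, fun i => (hy.2 i).le⟩
  exact interior_maximal hsub hopen ⟨h0, h⟩

lemma closure_core_subset :
    closure (T.core ρ) ⊆ {x | 0 ≤ T.power x ∧ ∀ i, T.power x ≤ T.ratio i ρ * T.bary i x} := by
  have hp := T.continuous_power
  have hb := fun i => T.continuous_bary i
  refine closure_minimal (fun x hx => ⟨hx.1.le, hx.2⟩) ?_
  simp only [ofPred_and, ofPred_forall]
  exact (isClosed_le continuous_const hp).inter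
    (isClosed_iInter fun i => isClosed_le hp ((hb i).const_mul _))

/-- A frontier point of the core lies on one of the spheres and in the core, or is a vertex. -/
lemma frontier_core_subset (hρ : T.circumradius < ρ) {x : E3} (hx : x ∈ frontier (T.core ρ)) :
    (∃ i, x ∈ {x ∈ T.core ρ | T.power x = T.ratio i ρ * T.bary i x}) ∨ x ∈ vertexSet T := by
  obtain ⟨h0, h1⟩ := closure_core_subset hx.1
  rcases h0.lt_or_eq with h0 | h0
  · left
    by_contra! hcon
    refine hx.2 (mem_interior_core h0 fun i => (h1 i).lt_of_ne fun h => ?_)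
    exact hcon i ⟨⟨h0, h1⟩, h⟩
  · right
    refine T.mem_vertexSet_of_power_eq_zero (fun i => ?_) h0.symm
    have := h1 i
    rw [← h0] at this
    exact nonneg_of_mul_nonneg_right this (ratio_pos hρ i)

lemma coreFace_subset_frontier (hρ : T.circumradius < ρ) (i : Fin 4) :
    {x ∈ T.core ρ | T.power x = T.ratio i ρ * T.bary i x} ⊆ frontier (T.core ρ) := by
  rintro x ⟨hx, hxi⟩
  refine ⟨subset_closure hx, fun hint => ?_⟩
  have hρ0 : ρ ≠ 0 := (T.circumradius_pos.trans hρ).ne'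
  have h1 : x ∈ closure (ball (T.faceCenter ρ i) ρ) := by
    rw [closure_ball _ hρ0]
    exact sphere_subset_closedBall ((mem_sphere_faceCenter hρ.le i).2 hxi)
  obtain ⟨y, hy, hyb⟩ := mem_closure_iff.1 h1 _ isOpen_interior hint
  rw [mem_ball_faceCenter hρ.le] at hyb
  exact absurd ((interior_subset hy).2 i) (not_le.2 hyb)

/-- Vertices in the closure of the core are limits of points of the core on the spheres. -/
lemma point_mem_closure_coreFace (hρ : T.circumradius < ρ) {j : Fin 4}
    (hj : T.points j ∈ closure (T.core ρ)) :
    ∃ i, T.points j ∈ closure {x ∈ T.core ρ | T.power x = T.ratio i ρ * T.bary i x} := by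
  rw [← mem_iUnion, ← closure_iUnion_of_finite, Metric.mem_closure_iff]
  intro ε hε
  -- avoid the other vertices
  obtain ⟨δ, hδ, hδV⟩ : ∃ δ > 0, ∀ k, k ≠ j → δ ≤ dist (T.points j) (T.points k) := by
    have hfin : (T.points '' {k | k ≠ j}).Finite := toFinite _
    have hnot : T.points j ∈ (T.points '' {k | k ≠ j})ᶜ := by
      rintro ⟨k, hk, hkj⟩
      exact hk (T.independent.injective hkj)
    obtain ⟨δ, hδ, hsub⟩ := Metric.isOpen_iff.1 hfin.isClosed.isOpen_compl _ hnot
    refine ⟨δ, hδ, fun k hk => ?_⟩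
    by_contra! hlt
    exact hsub (mem_ball'.2 hlt) ⟨k, hk, rfl⟩
  obtain ⟨y, hy, hyd⟩ := Metric.mem_closure_iff.1 hj (min ε δ) (lt_min hε hδ)
  have hr := T.circumradius_pos
  set s := dist (T.points j) y with hs
  have hs0 : 0 < s := by
    refine dist_pos.2 fun h => ?_
    have : 0 < T.power y := hy.1
    rw [← h, power_point] at this
    exact lt_irrefl _ this
  -- On the sphere of radius s about the vertex, y lies in the core and q lies outside the
  -- circumball, so by connectedness this sphere meets the frontier. It is too small to contain
  -- another vertex.
  set q := T.points j + (s / T.circumradius) • (T.points j - T.circumcenter) with hq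
  have hqs : q ∈ sphere (T.points j) s := by
    rw [mem_sphere, dist_eq_norm, hq, add_sub_cancel_left, norm_smul, norm_point_sub,
      Real.norm_of_nonneg (by positivity)]
    field_simp
  have hqP : T.power q < 0 := by
    have : q - T.circumcenter = (1 + s / T.circumradius) • (T.points j - T.circumcenter) := by
      rw [hq]; module
    rw [power, this, norm_smul, norm_point_sub, Real.norm_of_nonneg (by positivity)]
    have h1 : (1 + s / T.circumradius) * T.circumradius = T.circumradius + s := by field_simp
    rw [h1]; nlinarith
  have hrank : 1 < Module.rank ℝ E3 := by
    rw [← Module.finrank_eq_rank]; simp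
  obtain ⟨p, hps, hpf⟩ := (isPreconnected_sphere hrank (T.points j) s).inter_frontier_nonempty
    ⟨y, by rw [mem_sphere, dist_comm], hy⟩
    ⟨q, hqs, fun h => lt_asymm hqP h.1⟩
  rw [mem_sphere, dist_comm] at hps
  refine ⟨p, ?_, by rw [hps]; exact hyd.trans_le (min_le_left _ _)⟩
  rcases frontier_core_subset hρ hpf with h | ⟨k, rfl⟩
  · exact mem_iUnion.2 h
  · have hk : k ≠ j := by
      rintro rfl
      simp only [dist_self] at hps
      linarith
    have := hδV k hk
    have := hyd.trans_le (min_le_right _ _)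
    linarith

/-- The closures account for vertices, which are never in the core but may be limits of it. -/
lemma frontier_core (hρ : T.circumradius < ρ) :
    frontier (T.core ρ) =
      ⋃ i, closure {x ∈ T.core ρ | T.power x = T.ratio i ρ * T.bary i x} := by
  refine Subset.antisymm (fun x hx => ?_) (iUnion_subset fun i =>
    closure_minimal (coreFace_subset_frontier hρ i) isClosed_frontier)
  rw [mem_iUnion]
  rcases frontier_core_subset hρ hx with ⟨i, h⟩ | ⟨j, rfl⟩
  · exact ⟨i, subset_closure h⟩
  · exact point_mem_closure_coreFace hρ hx.1

lemma closure_coreFace_subset (hρ : T.circumradius < ρ) (i : Fin 4) :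
    closure {x ∈ T.core ρ | T.power x = T.ratio i ρ * T.bary i x} ⊆
      sphere (T.faceCenter ρ i) ρ :=
  closure_minimal (fun _ hx => (mem_sphere_faceCenter hρ.le i).2 hx.2) isClosed_sphere

end Affine.Simplex

/-! ### The critical radius -/

namespace Affine.Simplex

variable {T : Affine.Simplex ℝ E3 3} {ρ : ℝ}

lemma isFull_of_lt (hρ : T.circumradius < ρ) {x : E3} (h0 : 0 < T.power x)
    (h : ∀ i, T.power x < T.ratio i ρ * T.bary i x) : IsFull T ρ := by
  refine ⟨x, interior_mono ?_ (mem_interior_core h0 h)⟩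
  rw [hulloid_eq hρ]
  exact subset_union_right

lemma core_nonempty_of_isFull (hρ : T.circumradius < ρ) (h : IsFull T ρ) :
    (T.core ρ).Nonempty := by
  by_contra hne
  rw [IsFull, hulloid_eq hρ, not_nonempty_iff_eq_empty.1 hne, union_empty] at h
  have hd : Dense (vertexSet T)ᶜ := (finite_range T.points).countable.dense_compl ℝ
  rw [interior_eq_empty_iff_dense_compl.2 hd] at h
  exact not_nonempty_empty h

/-- The ratios tend to infinity, so the centroid eventually lies strictly inside the core. This
keeps the infimum from being taken over the empty set. -/
lemma exists_isFull : ∃ ρ, T.circumradius < ρ ∧ IsFull T ρ := by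
  have hc : ∀ i, 0 < T.bary i (Finset.univ.centroid ℝ T.points) :=
    T.mem_interior_solid.1 (T.basis.centroid_mem_interior_convexHull)
  set x := Finset.univ.centroid ℝ T.points
  have hP := T.power_pos hc
  obtain ⟨ρ, hρ, h⟩ := exists_forall_lt_ratio (T := T) (∑ i, T.power x / T.bary i x)
  refine ⟨ρ, hρ, isFull_of_lt hρ hP fun i => ?_⟩
  rw [← div_lt_iff₀ (hc i)]
  exact (Finset.single_le_sum (f := fun i => T.power x / T.bary i x)
    (fun j _ => (div_pos hP (hc j)).le) (Finset.mem_univ i)).trans_lt (h i)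

variable (T) in
lemma circumradius_le_criticalRadius : T.circumradius ≤ criticalRadius T :=
  le_csInf exists_isFull fun _ h => h.1.le

lemma mem_core_of_lt {ρ' : ℝ} (hρ : T.circumradius < ρ) (h : ρ < ρ') {x : E3}
    (hx : x ∈ T.core ρ) (i : Fin 4) : T.power x < T.ratio i ρ' * T.bary i x :=
  (hx.2 i).trans_lt
    (mul_lt_mul_of_pos_right (ratio_lt hρ h i) (bary_pos_of_mem_core hρ.le hx i))

/-- A core point at a smaller full radius satisfies strict inequalities at ρ, whereas nonpositive
excess would force equalities. -/
lemma excess_pos (h : criticalRadius T < ρ) : 0 < T.excess ρ := by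
  obtain ⟨ρ', ⟨h1, h2⟩, h3⟩ := exists_lt_of_csInf_lt exists_isFull h
  obtain ⟨x, hx⟩ := core_nonempty_of_isFull h1 h2
  by_contra! hC
  have hlt := mem_core_of_lt h1 h3 hx
  exact (hlt 0).ne (power_eq_of_excess_nonpos (h1.trans h3) hC ⟨hx.1, fun i => (hlt i).le⟩ 0)

lemma core_eq_empty (hρ : T.circumradius < ρ) (h : ρ < criticalRadius T) : T.core ρ = ∅ := by
  by_contra hne
  obtain ⟨x, hx⟩ := nonempty_iff_ne_empty.2 hne
  obtain ⟨ρ', h1, h2⟩ := exists_between h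
  have hfull := isFull_of_lt (hρ.trans h1) hx.1 (mem_core_of_lt hρ h1 hx)
  have hbdd : BddBelow {ρ : ℝ | T.circumradius < ρ ∧ IsFull T ρ} :=
    ⟨T.circumradius, fun _ h => h.1.le⟩
  have hle : criticalRadius T ≤ ρ' := csInf_le hbdd ⟨hρ.trans h1, hfull⟩
  exact hle.not_gt h2

lemma continuousAt_excess (hρ : T.circumradius < ρ) : ContinuousAt T.excess ρ := by
  have hr : ∀ i, ContinuousAt (fun ρ => (T.ratio i ρ)⁻¹) ρ := fun i =>
    (continuous_ratio i).continuousAt.inv₀ (ratio_pos hρ i).ne'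
  have h1 : ContinuousAt T.weight ρ := by
    unfold weight; exact tendsto_finsetSum _ fun i _ => hr i
  have h2 : ContinuousAt T.weightVec ρ := by
    unfold weightVec; exact tendsto_finsetSum _ fun i _ => (hr i).smul continuousAt_const
  unfold excess
  exact h1.sub ((continuousAt_const.mul (h1.pow 2)).sub (h2.norm.pow 2))

/-- It is a limit of positive values from the right; were it positive, the core would be nonempty
slightly below the critical radius. -/
lemma excess_criticalRadius (h : T.circumradius < criticalRadius T) :
    T.excess (criticalRadius T) = 0 := by
  have hc := continuousAt_excess h
  apply le_antisymm
  · by_contra! hpos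
    have h1 : ∀ᶠ ρ in nhdsWithin (criticalRadius T) (Iio (criticalRadius T)), 0 < T.excess ρ :=
      (hc.eventually_const_lt hpos).filter_mono nhdsWithin_le_nhds
    obtain ⟨ρ, h2, h3⟩ := (h1.and (Ioo_mem_nhdsLT h)).exists
    exact (isConnected_core h3.1 h2).nonempty.ne_empty (core_eq_empty h3.1 h3.2)
  · exact ge_of_tendsto (hc.mono_left (nhdsWithin_le_nhds (s := Ioi (criticalRadius T))))
      (Filter.eventually_of_mem self_mem_nhdsWithin fun ρ hρ => (excess_pos hρ).le)

lemma hulloid_eq_vertexSet (h0 : 0 < ρ) (h : ρ < criticalRadius T) :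
    hulloid ρ (vertexSet T) = vertexSet T := by
  rcases lt_or_ge T.circumradius ρ with hρ | hρ
  · rw [hulloid_eq hρ, core_eq_empty hρ h, union_empty]
  · exact Subset.antisymm ((hulloid_mono h0 hρ _).trans_eq hulloid_circumradius)
      (subset_hulloid _)

end Affine.Simplex

theorem corollary4p1 (T : Affine.Simplex ℝ E3 3) :
    -- `o ρ i` is the centre of `B_i(ρ)`; it exists and is unique for `ρ > r(V)`
    ∃ o : ℝ → Fin 4 → E3,
      (∀ ρ, T.circumradius < ρ → ∀ i p, IsFaceCenter T i ρ p ↔ p = o ρ i) ∧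
      (∀ ρ, 0 < ρ → ρ < criticalRadius T → hulloid ρ (vertexSet T) = vertexSet T) ∧
      (∀ ρ, criticalRadius T < ρ →
        T.circumradius < ρ ∧
        hulloid ρ (vertexSet T) = vertexSet T ∪ innerPart T (o ρ) ρ ∧
        IsConnected (innerPart T (o ρ) ρ) ∧
        ∃ S : Fin 4 → Set E3,
          (∀ i, S i ⊆ sphere (o ρ i) ρ ∧ IsConnected (S i)) ∧
          frontier (innerPart T (o ρ) ρ) = ⋃ i, S i) ∧
      T.circumradius ≤ criticalRadius T ∧
      (T.circumradius < criticalRadius T →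
        ∃ O ∈ interior (solid T),
          (⋂ i, sphere (o (criticalRadius T) i) (criticalRadius T)) = {O} ∧
          hulloid (criticalRadius T) (vertexSet T) = vertexSet T ∪ {O}) ∧
      (criticalRadius T = T.circumradius →
        hulloid (criticalRadius T) (vertexSet T) = vertexSet T) := by
  refine ⟨T.faceCenter, fun ρ hρ i p => Affine.Simplex.isFaceCenter_iff hρ i p,
    fun ρ h0 h => Affine.Simplex.hulloid_eq_vertexSet h0 h, fun ρ h => ?_,
    T.circumradius_le_criticalRadius, fun h => ?_, fun h => ?_⟩
  · have hρ := T.circumradius_le_criticalRadius.trans_lt h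
    have hC := Affine.Simplex.excess_pos h
    rw [Affine.Simplex.innerPart_eq_core hρ.le]
    exact ⟨hρ, Affine.Simplex.hulloid_eq hρ, Affine.Simplex.isConnected_core hρ hC, _,
      fun i => ⟨Affine.Simplex.closure_coreFace_subset hρ i,
        (Affine.Simplex.isConnected_coreFace hρ hC i).closure⟩,
      Affine.Simplex.frontier_core hρ⟩
  · obtain ⟨O, hO, h1, h2⟩ :=
      Affine.Simplex.exists_eq_singleton h (Affine.Simplex.excess_criticalRadius h)
    exact ⟨O, hO, h1, by rw [Affine.Simplex.hulloid_eq h, h2]⟩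
  · rw [h]; exact Affine.Simplex.hulloid_circumradius
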